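/- **Sleeping model.** A network is a connected undirected graph $G=(V,E)$ with $n=|V|\ge 1$ vertices. Computation proceeds in synchronous clock rounds $0,1,2,\dots$, and in each round every vertex is either awake or asleep. An awake vertex can send a message of arbitrary size through each of its ports (the incident edges, numbered arbitrarily at each vertex), receives the messages that its awake neighbours send to it in this round, and performs arbitrary local computation. A sleeping vertex neither sends nor receives (messages sent to it are lost) and does not compute; whether a vertex is awake in a given round is determined by the round number and by its state after its last previous awake round (by its initial state if there is none). Initially a vertex knows only its identifier, its degree and a number $\hat n$; the identifiers are distinct elements of $\{1,\dots,\hat n\}$, so $\hat n\ge n$ (the case $\hat n=n$ is the one in which $n$ is known). All vertices run the same deterministic algorithm. The *worst-case awake time* is the maximum over all vertices of the number of rounds in which the vertex is awake; the algorithm *terminates within $R$ clock rounds* if no vertex is awake in any round $r\ge R$. **DLT problem.** A *distributed layered tree (DLT)* of $G$ is a rooted spanning tree of $G$, oriented towards its root, with a label from a linearly ordered set at each vertex, such that the label of every non-root vertex is greater than the label of its parent. To solve the DLT problem, the vertices have to produce such a tree as follows: each vertex outputs its own label, and each non-root vertex also outputs the port leading to its parent and the label of its parent; the root outputs that it is the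 root. Let $\log$ be the base-2 logarithm, and let $\log^* m$ be the least $k\ge 0$ such that applying $\log$ to $m$ successively $k$ times gives a value $\le 1$. **Theorem.** There are a deterministic algorithm and an absolute constant $C$ such that, on every connected network with $n$ vertices and with distinct identifiers from $\{1,\dots,\hat n\}$, the algorithm solves the DLT problem, its worst-case awake time is at most $C(\log n\cdot\log^* n+1)$, and it terminates within $C(\hat n\log\hat n\cdot\log^*\hat n+1)$ clock rounds. Moreover, the label of each vertex $v$ in the tree that it produces is the pair $(\mathrm{ID}(r),\ell)$, where $r$ is the root and $\ell$ is the distance from $r$ to $v$ in the tree; pairs are ordered lexicographically. In particular, if $n$ is known (that is, $\hat n=n$), the algorithm has worst-case awake time $O(\log n\log^* n)$ and terminates within $O(n\log n\log^* n)$ clock rounds. -/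

import Mathlib

namespace Sleeping

/-- A communication network on the vertex set `V`: an undirected graph, at every vertex a numbering
`0, …, deg v - 1` of the incident edges (ports), and distinct identifiers. The port numberings at
the two ends of an edge are unrelated. -/
structure Network (V : Type*) where
  graph : SimpleGraph V
  deg : V → ℕ
  port : ∀ v, Fin (deg v) ≃ graph.neighborSet v
  ident : V → ℕ
  ident_injective : Function.Injective ident

/-- The neighbour of `v` behind port `p`, if `v` has such a port. -/
def Network.neighbor? {V : Type*} (N : Network V) (v : V) (p : ℕ) : Option V :=
  if h : p < N.deg v then some (N.port v ⟨p, h⟩ : V) else none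

/-- A deterministic algorithm in the sleeping model; all vertices run the same one. Messages and
local computation are unrestricted, as in the LOCAL model.
* `start nhat i d` is the initial state of a vertex that knows the bound `nhat` on the number of
  vertices, its own identifier `i` and its degree `d`.
* `awake s r` tells whether a vertex whose state is `s` is awake in clock round `r`. The state of a
  vertex changes only in its awake rounds, so this is decided in the last awake round before `r`
  (or is hard-coded in the algorithm).
* In an awake round `r` the vertex sends the message `send s r p` through port `p`
  (`none`: nothing), and from what it receives through its ports in the same round it computes its
  next state.
* `output s` is the output stored in the state `s`. -/
structure Algorithm (Out : Type) where
  State : Type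
  Msg : Type
  start : ℕ → ℕ → ℕ → State
  awake : State → ℕ → Bool
  send : State → ℕ → ℕ → Option Msg
  next : State → ℕ → (ℕ → Option Msg) → State
  output : State → Out

section Execution

variable {V : Type*} {Out : Type} (A : Algorithm Out) (N : Network V) (nhat : ℕ)

/-- What arrives at `v` through port `p` in round `r` when the states at the beginning of this round
are `s`: the message that the neighbour `u` behind this port sends along the common edge, provided
that `u` is awake. -/
def inbox (s : V → A.State) (r : ℕ) (v : V) (p : ℕ) : Option A.Msg :=
  if h : p < N.deg v then
    let u := N.port v ⟨p, h⟩
    if A.awake (s u) r then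
      A.send (s u) r ((N.port u).symm ⟨v, SimpleGraph.Adj.symm u.2⟩)
    else none
  else none

/-- The states at the beginning of each clock round. A sleeping vertex receives nothing and keeps
its state. -/
def states : ℕ → V → A.State
  | 0, v => A.start nhat (N.ident v) (N.deg v)
  | r + 1, v =>
    if A.awake (states r v) r then A.next (states r v) r (inbox A N (states r) r v)
    else states r v

/-- Vertex `v` is awake in clock round `r`. -/
def IsAwake (v : V) (r : ℕ) : Prop := A.awake (states A N nhat r v) r = true

/-- The execution is over after the clock rounds `0, …, R - 1`: no vertex is ever awake later. -/
def TerminatesWithin (R : ℕ) : Prop := ∀ v r, R ≤ r → ¬ IsAwake A N nhat v r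

open scoped Classical in
/-- The number of rounds among `0, …, R - 1` in which `v` is awake. -/
noncomputable def awakeTime (R : ℕ) (v : V) : ℕ :=
  ((Finset.range R).filter fun r => IsAwake A N nhat v r).card

end Execution

/-- The undirected graph formed by the edges from vertices to their parents. -/
def parentGraph {V : Type*} (parent : V → Option V) : SimpleGraph V :=
  SimpleGraph.fromRel fun v u => parent v = some u

/-- `parent` describes a spanning tree of `G`, rooted at `root` and with all edges oriented towards
the root. -/
structure IsRootedSpanningTree {V : Type*} (G : SimpleGraph V) (root : V)
    (parent : V → Option V) : Prop where
  le : parentGraph parent ≤ G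
  isTree : (parentGraph parent).IsTree
  root_parent : parent root = none
  parent_closer : ∀ v, v ≠ root → ∃ u, parent v = some u ∧
    (parentGraph parent).dist root v = (parentGraph parent).dist root u + 1

/-- What a single vertex holds of a distributed layered tree: its own label and, unless it is the
root, the port that leads to its parent and the label of its parent. -/
structure DLTOutput (Label : Type) where
  label : Label
  parent : Option (ℕ × Label)

/-- The parents that the vertices point to. -/
def parentOf {V : Type*} {Label : Type} (N : Network V) (out : V → DLTOutput Label) (v : V) :
    Option V :=
  (out v).parent.bind fun q => N.neighbor? v q.1

/-- The outputs of the vertices form a distributed layered tree of the network with root `root`: a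
rooted oriented spanning tree in which every label is greater than the label of the parent, and
every vertex knows the label of its parent. -/
structure IsDLT {V : Type*} {Label : Type} [LinearOrder Label] (N : Network V)
    (out : V → DLTOutput Label) (root : V) : Prop where
  tree : IsRootedSpanningTree N.graph root (parentOf N out)
  root_output : (out root).parent = none
  label_lt : ∀ v u, parentOf N out v = some u → (out u).label < (out v).label
  knows_label : ∀ v u, parentOf N out v = some u →
    (out v).parent.map Prod.snd = some (out u).label

/-- The iterated logarithm: how often the base-2 logarithm has to be applied to `n` to reach a
value of at most `1`. -/
noncomputable def logStar (n : ℕ) : ℕ := sInf {k : ℕ | (Real.logb 2)^[k] (n : ℝ) ≤ 1}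

end Sleeping

/-! The construction is in the manner of Borůvka. The vertices maintain a spanning forest, each
knowing its root and depth, and its trees (fragments) merge in phases; at the start of phase `p`
every fragment has at least `2 ^ p` vertices. Let `D = 2 ^ (p + 1)`. A fragment with a vertex of
depth at least `D` already has `D` vertices and makes no proposal. Every other fragment picks one
outgoing edge, its proposal; if there is none, it spans the network and the run ends.

Fragments must attach themselves along proposals without creating cycles. One Cole–Vishkin step on
root identifiers gives the fragments `K = O(log nhat)` colors that differ at the two ends of each
proposal (`hue_ne`). A proposing fragment moves if its proposal goes to a smaller color, or if no
fragment of larger color proposes to it. A proposing fragment that stays therefore receives one that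
moves, so every shallow fragment merges (`deep_or_merges`). Give a moving fragment of color `c` the
rank `c` if its proposal goes down and `2 * K + 1 - c` if it goes up. The rank drops from a moving
fragment to a moving target (`slot_lt_of_proposes`). Hence there are no cycles, and one sweep with a
window of `2 * D` rounds per rank carries the new labels along arbitrarily long chains of
attachments, each vertex listening once and speaking once.

A stage costs a vertex at most two awake rounds and a phase has eight stages, so the awake time is
`O(log n + 1)`. Stage lengths are `O(D * K)` and double from phase to phase, so the clock time is a
geometric sum. Long stages cost no awake time, which is why a single coin-tossing step suffices; of
the iterated logarithm only `1 ≤ logStar n` for `n ≥ 2` is used. -/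

namespace Sleeping

/-! ### Algorithms that consist of stages -/

/-- A stage of `len` clock rounds. A vertex whose state is `s` listens once, in round `listen s` of
the stage, and then updates its state; it speaks once, in round `speak s`, when it sends its state
and the port number through every port. -/
structure Stage (S : Type) where
  len : ℕ
  listen : S → ℕ
  speak : S → ℕ
  upd : S → (ℕ → Option (S × ℕ)) → S

/-- The stage and the round within this stage that belong to a clock round. -/
def clock (len : ℕ → ℕ) : ℕ → ℕ × ℕ
  | 0 => (0, 0)
  | r + 1 =>
    if (clock len r).2 + 1 < len (clock len r).1 then ((clock len r).1, (clock len r).2 + 1)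
    else ((clock len r).1 + 1, 0)

/-- The clock round in which a stage starts. -/
def startTime (len : ℕ → ℕ) (i : ℕ) : ℕ := ∑ j ∈ Finset.range i, len j

theorem startTime_succ (len : ℕ → ℕ) (i : ℕ) :
    startTime len (i + 1) = startTime len i + len i := Finset.sum_range_succ _ _

theorem clock_startTime_add {len : ℕ → ℕ} (hlen : ∀ i, 0 < len i) (i o : ℕ) (ho : o < len i) :
    clock len (startTime len i + o) = (i, o) := by
  induction i generalizing o with
  | zero =>
    induction o with
    | zero => simp [startTime, clock]
    | succ o ih =>
      have := ih (by omega)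
      rw [← add_assoc, clock, this, if_pos ho]
  | succ i ih =>
    induction o with
    | zero =>
      have h := ih (len i - 1) (by have := hlen i; omega)
      have e : startTime len (i + 1) + 0 = startTime len i + (len i - 1) + 1 := by
        rw [startTime_succ]; have := hlen i; omega
      rw [e, clock, h, if_neg (by simp only; omega)]
    | succ o ih' =>
      have := ih' (by omega)
      rw [← add_assoc, clock, this, if_pos ho]

theorem clock_snd_lt {len : ℕ → ℕ} (hlen : ∀ i, 0 < len i) (r : ℕ) :
    (clock len r).2 < len (clock len r).1 := by
  induction r with
  | zero => exact hlen 0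
  | succ r ih =>
    rw [clock]
    split_ifs with h
    · exact h
    · exact hlen _

section Staged

variable {S Out : Type} (plan : ℕ → ℕ → Stage S) (init : ℕ → ℕ → ℕ → S) (out : S → Out)

/-- The length of the `i`-th stage. -/
def stageLen (nhat i : ℕ) : ℕ := (plan nhat i).len

/-- The algorithm that goes through a sequence of stages. -/
def stagedAlgorithm : Algorithm Out where
  State := ℕ × S
  Msg := S × ℕ
  start nhat i d := (nhat, init nhat i d)
  awake s r :=
    let c := clock (stageLen plan s.1) r
    decide (c.2 = (plan s.1 c.1).listen s.2) || decide (c.2 = (plan s.1 c.1).speak s.2)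
  send s r p :=
    let c := clock (stageLen plan s.1) r
    if c.2 = (plan s.1 c.1).speak s.2 then some (s.2, p) else none
  next s r inb :=
    let c := clock (stageLen plan s.1) r
    if c.2 = (plan s.1 c.1).listen s.2 then (s.1, (plan s.1 c.1).upd s.2 inb) else s
  output s := out s.2

end Staged

/-! ### Edges seen from both ends, and the messages that arrive through them -/

/-- Port `p` of `v` and port `q` of `u` belong to the same edge. -/
def Network.Link {V : Type*} (N : Network V) (v : V) (p : ℕ) (u : V) (q : ℕ) : Prop :=
  ∃ (h : p < N.deg v) (e : (N.port v ⟨p, h⟩ : V) = u),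
    ((N.port u).symm ⟨v, SimpleGraph.Adj.symm (e ▸ (N.port v ⟨p, h⟩).2)⟩ : ℕ) = q

section Link

variable {V : Type*} {N : Network V} {v u w : V} {p q p' q' : ℕ}

theorem Network.Link.lt (h : N.Link v p u q) : p < N.deg v := h.1

theorem Network.Link.adj (h : N.Link v p u q) : N.graph.Adj v u := by
  obtain ⟨h, e, -⟩ := h
  exact e ▸ (N.port v ⟨p, h⟩).2

theorem Network.Link.neighbor? (h : N.Link v p u q) : N.neighbor? v p = some u := by
  obtain ⟨h, e, -⟩ := h
  simp [Network.neighbor?, h, e]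

theorem Network.Link.symm (h : N.Link v p u q) : N.Link u q v p := by
  obtain ⟨h, e, rfl⟩ := h
  subst e
  refine ⟨Fin.isLt _, by simp, ?_⟩
  have : ∀ (x : N.graph.neighborSet v), x = N.port v ⟨p, h⟩ → ((N.port v).symm x : ℕ) = p := by
    rintro x rfl; simp
  exact this _ rfl

theorem Network.Link.unique (h : N.Link v p u q) (h' : N.Link v p w q') : u = w ∧ q = q' := by
  obtain ⟨h, e, rfl⟩ := h
  obtain ⟨_, e', rfl⟩ := h'
  subst e
  subst e'
  exact ⟨rfl, rfl⟩

theorem Network.exists_link (h : N.graph.Adj v u) : ∃ p q, N.Link v p u q :=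
  ⟨(N.port v).symm ⟨u, h⟩, _, Fin.isLt _, by simp, rfl⟩

end Link

/-- What arrives at `v` through its ports if every neighbour `u` sends the content `f v u` and the
port number. -/
def inboxOf {V : Type*} {S : Type} (N : Network V) (f : V → V → Option S) (v : V)
    (p : ℕ) : Option (S × ℕ) :=
  if h : p < N.deg v then
    (f v (N.port v ⟨p, h⟩)).map fun s =>
      (s, ((N.port (N.port v ⟨p, h⟩)).symm ⟨v, SimpleGraph.Adj.symm (N.port v ⟨p, h⟩).2⟩ : ℕ))
  else none

theorem inboxOf_eq_some {V : Type*} {S : Type} {N : Network V} {f : V → V → Option S} {v : V}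
    {p : ℕ} {m : S × ℕ} :
    inboxOf N f v p = some m ↔ ∃ u, N.Link v p u m.2 ∧ f v u = some m.1 := by
  unfold inboxOf
  constructor
  · intro h
    split_ifs at h with h'
    simp only [Option.map_eq_some_iff] at h
    obtain ⟨s, h1, rfl⟩ := h
    exact ⟨_, ⟨h', rfl, rfl⟩, h1⟩
  · rintro ⟨u, ⟨h, e, e'⟩, h'⟩
    subst e
    rw [dif_pos h, h']
    simp only [Option.map_some, Option.some.injEq]
    exact Prod.ext rfl e'

/-! ### A whole stage as a single step -/

/-- The stage `g` leads from the states `σ` to the states `σ'`. -/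
def StageStep {V : Type*} {S : Type} (N : Network V) (g : Stage S) (σ σ' : V → S) : Prop :=
  ∀ v, σ' v =
    if g.listen (σ v) < g.len then
      g.upd (σ v) (inboxOf N (fun v u =>
        if g.speak (σ u) = g.listen (σ v) then
          some (if g.listen (σ u) < g.speak (σ u) then σ' u else σ u)
        else none) v)
    else σ v

/-- The update that follows the listening round does not change the later schedule of the stage. -/
def Stage.Steady {S : Type} (g : Stage S) : Prop :=
  ∀ s inb, g.listen s + 1 < g.len →
    g.listen (g.upd s inb) = g.listen s ∧ g.speak (g.upd s inb) = g.speak s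

section Run

variable {V : Type*} {S Out : Type} (plan : ℕ → ℕ → Stage S) (init : ℕ → ℕ → ℕ → S)
  (out : S → Out) (N : Network V) (nhat : ℕ)

/-- The states of the vertices of a staged algorithm at the beginning of a clock round. -/
def run (r : ℕ) (v : V) : S := (states (stagedAlgorithm plan init out) N nhat r v).2

theorem states_staged_fst (r : ℕ) (v : V) :
    (states (stagedAlgorithm plan init out) N nhat r v).1 = nhat := by
  induction r with
  | zero => rfl
  | succ r ih =>
    rw [states]
    split_ifs
    · simp only [stagedAlgorithm] at ih ⊢
      split_ifs
      · exact ih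
      · exact ih
    · exact ih

variable {plan init out N nhat}

theorem isAwake_staged_iff (hlen : ∀ i, 0 < stageLen plan nhat i) {i o : ℕ}
    (ho : o < stageLen plan nhat i) (v : V) :
    IsAwake (stagedAlgorithm plan init out) N nhat v (startTime (stageLen plan nhat) i + o) ↔
      o = (plan nhat i).listen (run plan init out N nhat (startTime (stageLen plan nhat) i + o) v) ∨
      o = (plan nhat i).speak
        (run plan init out N nhat (startTime (stageLen plan nhat) i + o) v) := by
  have h1 := states_staged_fst plan init out N nhat (startTime (stageLen plan nhat) i + o) v
  unfold IsAwake run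
  generalize states (stagedAlgorithm plan init out) N nhat
    (startTime (stageLen plan nhat) i + o) v = x at h1 ⊢
  obtain ⟨a, s⟩ := x
  obtain rfl : a = nhat := h1
  simp [stagedAlgorithm, clock_startTime_add hlen i o ho]

theorem run_succ (hlen : ∀ i, 0 < stageLen plan nhat i) {i o : ℕ}
    (ho : o < stageLen plan nhat i) (v : V) :
    run plan init out N nhat (startTime (stageLen plan nhat) i + o + 1) v =
      let τ := run plan init out N nhat (startTime (stageLen plan nhat) i + o)
      if o = (plan nhat i).listen (τ v) then
        (plan nhat i).upd (τ v)
          (inboxOf N (fun _ u => if o = (plan nhat i).speak (τ u) then some (τ u) else none) v)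
      else τ v := by
  have hc := clock_startTime_add hlen i o ho
  have haw := isAwake_staged_iff (init := init) (out := out) (N := N) hlen ho
  have hst : ∀ u, states (stagedAlgorithm plan init out) N nhat
      (startTime (stageLen plan nhat) i + o) u =
      (nhat, run plan init out N nhat (startTime (stageLen plan nhat) i + o) u) := fun u =>
    Prod.ext (states_staged_fst plan init out N nhat _ u) rfl
  have hin : ∀ p, inbox (stagedAlgorithm plan init out) N
      (states (stagedAlgorithm plan init out) N nhat (startTime (stageLen plan nhat) i + o))
      (startTime (stageLen plan nhat) i + o) v p =
      inboxOf N (fun _ u => if o = (plan nhat i).speak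
        (run plan init out N nhat (startTime (stageLen plan nhat) i + o) u) then
        some (run plan init out N nhat (startTime (stageLen plan nhat) i + o) u) else none) v p := by
    intro p
    unfold inbox inboxOf
    split_ifs with h
    · simp only [hst]
      simp only [stagedAlgorithm, hc, Bool.or_eq_true, decide_eq_true_eq]
      by_cases hq : o = (plan nhat i).speak
          (run plan init out N nhat (startTime (stageLen plan nhat) i + o) (N.port v ⟨p, h⟩))
      · simp only [← hq, or_true, if_true, Option.map_some]
      · simp only [hq, if_false, ite_self, Option.map_none]
    · rfl
  have hin' := funext hin
  simp only
  conv_lhs => rw [run, states]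
  rw [hin']
  split_ifs with h1 h2 h2
  · rw [hst]
    simp only [stagedAlgorithm, hc]
    rw [if_pos h2]
  · rw [hst]
    simp only [stagedAlgorithm, hc]
    rw [if_neg h2]
  · exact absurd ((haw v).2 (Or.inl h2)) h1
  · rfl

variable (hlen : ∀ i, 0 < stageLen plan nhat i) (hsteady : ∀ i, (plan nhat i).Steady)

include hlen hsteady in
/-- The states during a stage: they change only in the listening round. -/
theorem run_during (i : ℕ) (v : V) (o : ℕ) (ho : o ≤ stageLen plan nhat i) :
    let T := startTime (stageLen plan nhat) i
    let τ := fun o => run plan init out N nhat (T + o) v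
    let l := (plan nhat i).listen (τ 0)
    (o ≤ l → τ o = τ 0) ∧ (l < o → τ o = τ (l + 1) ∧
      (o < stageLen plan nhat i → (plan nhat i).listen (τ o) = l ∧
        (plan nhat i).speak (τ o) = (plan nhat i).speak (τ 0))) := by
  intro T τ l
  induction o with
  | zero => exact ⟨fun _ => rfl, fun h => absurd h (by omega)⟩
  | succ o ih =>
    obtain ⟨ih1, ih2⟩ := ih (by omega)
    have hs := run_succ (init := init) (out := out) (N := N) hlen (i := i) (o := o) (by omega) v
    simp only at hs
    change τ (o + 1) = if o = (plan nhat i).listen (τ o) then _ else τ o at hs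
    refine ⟨fun h => ?_, fun h => ?_⟩
    · have h0 := ih1 (by omega)
      rw [hs, h0, if_neg]
      change ¬ o = l
      omega
    · rcases Nat.lt_or_ge l o with h' | h'
      · obtain ⟨e1, e2⟩ := ih2 h'
        obtain ⟨e3, e4⟩ := e2 (by omega)
        rw [if_neg (by omega)] at hs
        rw [hs]
        exact ⟨e1, fun _ => ⟨e3, e4⟩⟩
      · obtain rfl : o = l := by omega
        refine ⟨rfl, fun h'' => ?_⟩
        have h0 := ih1 le_rfl
        rw [if_pos (by rw [h0])] at hs
        rw [hs]
        -- `Steady` speaks only about updates after which a round of the stage remains, which `h''`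
        -- provides.
        have h1 : (plan nhat i).listen (τ l) + 1 < stageLen plan nhat i := by rw [h0]; exact h''
        exact ⟨(hsteady i _ _ h1).1.trans (congrArg _ h0),
          (hsteady i _ _ h1).2.trans (congrArg _ h0)⟩

-- A state changes only in its listening round, so a neighbour sends its final state if it has
-- listened before it speaks, and its initial state otherwise. The final states thus occur on both
-- sides, and a wave through a tree becomes one implicit equation instead of a round-by-round
-- account.
include hlen hsteady in
theorem stageStep_run (i : ℕ) :
    StageStep N (plan nhat i) (run plan init out N nhat (startTime (stageLen plan nhat) i))
      (run plan init out N nhat (startTime (stageLen plan nhat) (i + 1))) := by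
  intro v
  set T := startTime (stageLen plan nhat) i with hT
  rw [startTime_succ, ← hT]
  have hd := fun u o ho => run_during (init := init) (out := out) (N := N) hlen hsteady i u o ho
  simp only [← hT, add_zero] at hd
  have hL : stageLen plan nhat i = (plan nhat i).len := rfl
  split_ifs with h
  · rw [(hd v _ le_rfl).2 (by omega) |>.1]
    have hs := run_succ (init := init) (out := out) (N := N) hlen
      (i := i) (o := (plan nhat i).listen (run plan init out N nhat T v)) (by omega) v
    rw [← add_assoc, ← hT] at *
    simp only at hs
    rw [hs, (hd v _ (by omega)).1 le_rfl, if_pos rfl]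
    congr 1
    set o := (plan nhat i).listen (run plan init out N nhat T v) with hodef
    funext p
    unfold inboxOf
    split_ifs with hp
    · congr 1
      generalize (N.port v ⟨p, hp⟩ : V) = u
      beta_reduce
      rw [← hodef]
      rcases Nat.lt_or_ge ((plan nhat i).listen (run plan init out N nhat T u)) o with hlt | hge
      · obtain ⟨e1, e2⟩ := (hd u o (by omega)).2 hlt
        obtain ⟨e3, e4⟩ := e2 (by omega)
        obtain ⟨e5, -⟩ := (hd u _ le_rfl).2 (lt_of_lt_of_le hlt (by omega))
        rw [e4]
        by_cases hq : o = (plan nhat i).speak (run plan init out N nhat T u)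
        · rw [if_pos hq, if_pos hq.symm, if_pos (by omega), e5, e1]
        · rw [if_neg hq, if_neg (fun h => hq h.symm)]
      · rw [(hd u o (by omega)).1 hge]
        by_cases hq : o = (plan nhat i).speak (run plan init out N nhat T u)
        · rw [if_pos hq, if_pos hq.symm, if_neg (by omega)]
        · rw [if_neg hq, if_neg (fun h => hq h.symm)]
    · rfl
  · exact (hd v _ le_rfl).1 (by omega)

-- Steadiness confines the awake rounds of a stage to the two that the state at its start
-- determines; rescheduling after listening could add a third.
include hlen hsteady in
theorem awakeTime_staged_le (i : ℕ) (v : V) :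
    awakeTime (stagedAlgorithm plan init out) N nhat (startTime (stageLen plan nhat) i) v
      ≤ 2 * i := by
  classical
  induction i with
  | zero => simp [awakeTime, startTime]
  | succ i ih =>
    set T := startTime (stageLen plan nhat) i with hT
    have hd := fun u o ho => run_during (init := init) (out := out) (N := N) hlen hsteady i u o ho
    simp only [← hT, add_zero] at hd
    have hsub : (Finset.range (startTime (stageLen plan nhat) (i + 1))).filter
        (fun r => IsAwake (stagedAlgorithm plan init out) N nhat v r) ⊆
        (Finset.range T).filter
          (fun r => IsAwake (stagedAlgorithm plan init out) N nhat v r) ∪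
        {T + (plan nhat i).listen (run plan init out N nhat T v),
          T + (plan nhat i).speak (run plan init out N nhat T v)} := by
      intro r hr
      rw [startTime_succ, ← hT] at hr
      simp only [Finset.mem_filter, Finset.mem_range, Finset.mem_union, Finset.mem_insert,
        Finset.mem_singleton] at hr ⊢
      rcases Nat.lt_or_ge r T with h | h
      · exact Or.inl ⟨h, hr.2⟩
      · right
        obtain ⟨o, rfl⟩ := Nat.exists_eq_add_of_le h
        have ho : o < stageLen plan nhat i := by omega
        have haw := (isAwake_staged_iff hlen ho v).1 hr.2
        rw [← hT] at haw
        rcases Nat.lt_or_ge ((plan nhat i).listen (run plan init out N nhat T v)) o with hlt | hge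
        · obtain ⟨e3, e4⟩ := ((hd v o ho.le).2 hlt).2 ho
          rw [e3, e4] at haw
          omega
        · rw [(hd v o ho.le).1 hge] at haw
          omega
    have h1 := Finset.card_le_card hsub
    have h2 := Finset.card_union_le ((Finset.range T).filter
          (fun r => IsAwake (stagedAlgorithm plan init out) N nhat v r))
        {T + (plan nhat i).listen (run plan init out N nhat T v),
          T + (plan nhat i).speak (run plan init out N nhat T v)}
    have h3 := Finset.card_le_two (a := T + (plan nhat i).listen (run plan init out N nhat T v))
      (b := T + (plan nhat i).speak (run plan init out N nhat T v))
    have e : ∀ R, awakeTime (stagedAlgorithm plan init out) N nhat R v =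
        ((Finset.range R).filter
          (fun r => IsAwake (stagedAlgorithm plan init out) N nhat v r)).card := fun R => by
      unfold awakeTime; congr!
    rw [e] at ih ⊢
    omega

end Run

/-! ### The algorithm -/

/-- What a vertex knows about itself and its place in the forest: its identifier, its degree, the
identifier of the root of its tree, its depth, and the port that leads to its parent. -/
structure Core where
  id : ℕ
  deg : ℕ
  root : ℕ
  depth : ℕ
  par : Option ℕ

/-- The state of a vertex. A *fragment* is the vertex set of a tree of the current forest.
* `out`: a port that leaves the fragment, and the root of the tree behind it;
* `sub`, `got`: items collected from the subtree of the vertex, and from its children by port;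
* `all`: items collected from the whole fragment;
* `color`: the color of the fragment, `0` if it makes no proposal;
* `npar`, `onPath`: the parent after moving the root to the vertex that makes the proposal, and
  whether the vertex lies on the path from there to the old root;
* `time`, `ptime`: the rounds in which the vertex and its parent speak in the final stage. -/
structure VState extends Core where
  done : Bool
  out : Option (ℕ × ℕ)
  sub : Finset (ℕ × ℕ)
  got : ℕ → Finset (ℕ × ℕ)
  all : Finset (ℕ × ℕ)
  color : ℕ
  npar : Option ℕ
  onPath : Prop
  time : ℕ
  ptime : ℕ

/-- The messages that arrive through the ports of a vertex. -/
abbrev Inbox := ℕ → Option (VState × ℕ)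

/-! ### Deterministic coin tossing -/

theorem exists_testBit_ne {x y : ℕ} (h : x ≠ y) : ∃ i, x.testBit i ≠ y.testBit i := by
  by_contra hc
  push Not at hc
  exact h (Nat.eq_of_testBit_eq hc)

open scoped Classical in
/-- One step of deterministic coin tossing (Cole and Vishkin): the position and the value of the
lowest bit in which `x` differs from `y`. -/
noncomputable def coinToss (x y : ℕ) : ℕ :=
  if h : x ≠ y then
    2 * Nat.find (exists_testBit_ne h) + (x.testBit (Nat.find (exists_testBit_ne h))).toNat
  else 0

/-- If the values agree, so do the two positions and the bits of `x` and `y` there, but this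
position was chosen because `x` and `y` differ in it. -/
theorem coinToss_ne {x y z : ℕ} (hxy : x ≠ y) (hyz : y ≠ z) : coinToss x y ≠ coinToss y z := by
  classical
  unfold coinToss
  rw [dif_pos hxy, dif_pos hyz]
  intro h
  have h1 := Nat.find_spec (exists_testBit_ne hxy)
  have b1 := Bool.toNat_lt (x.testBit (Nat.find (exists_testBit_ne hxy)))
  have b2 := Bool.toNat_lt (y.testBit (Nat.find (exists_testBit_ne hyz)))
  have e : Nat.find (exists_testBit_ne hxy) = Nat.find (exists_testBit_ne hyz) := by omega
  rw [e] at h1 h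
  apply h1
  cases hx : x.testBit (Nat.find (exists_testBit_ne hyz)) <;>
    cases hy : y.testBit (Nat.find (exists_testBit_ne hyz)) <;> simp_all

theorem coinToss_lt {x y m : ℕ} (hx : x ≤ m) (hy : y ≤ m) :
    coinToss x y < 2 * (Nat.log 2 m + 1) := by
  classical
  unfold coinToss
  split_ifs with h
  · have h1 := Nat.find_spec (exists_testBit_ne h)
    have b1 := Bool.toNat_lt (x.testBit (Nat.find (exists_testBit_ne h)))
    generalize Nat.find (exists_testBit_ne h) = i at *
    have : i < Nat.log 2 m + 1 := by
      by_contra hc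
      have hm : m < 2 ^ i :=
        (Nat.lt_pow_succ_log_self (by norm_num) m).trans_le
          (Nat.pow_le_pow_right (by norm_num) (by omega))
      rw [Nat.testBit_lt_two_pow (by omega), Nat.testBit_lt_two_pow (by omega)] at h1
      exact h1 rfl
    omega
  · omega

namespace VState

open scoped Classical

/-- The proposal of a fragment: the vertex that makes it, and the root of the tree it points to.
Fragments of too large a depth, which hold the item `(0, 0)`, do not propose. -/
noncomputable def pick (s : VState) : Option (ℕ × ℕ) :=
  if h : s.all.Nonempty ∧ (0, 0) ∉ s.all then some h.1.choose else none

/-- The color of a fragment that makes a proposal. -/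
noncomputable def hue (s : VState) : ℕ := (s.pick.map fun z => coinToss s.root z.2 + 1).getD 0

/-- The proposal of the fragment of the vertex is made by the vertex itself, through port `p`. -/
def Proposes (s : VState) (p : ℕ) : Prop :=
  ∃ z x, s.pick = some z ∧ z.1 = s.id ∧ s.out = some x ∧ x.1 = p

/-- The fragment of the vertex attaches itself to another one. -/
def Moves (s : VState) : Prop := s.color ≠ 0 ∧ ((0, 1) ∈ s.all ∨ (0, 0) ∉ s.all)

/-- The position of a fragment in the order in which the fragments get their new labels. -/
noncomputable def rank (K : ℕ) (s : VState) : ℕ :=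
  if (0, 1) ∈ s.all then s.color else 2 * K + 1 - s.color

/-- The round in which a vertex speaks in the last stage of a phase, where `D` bounds the depth and
`K` bounds the colors. -/
noncomputable def slot (D K : ℕ) (s : VState) : ℕ :=
  if s.Moves then
    s.rank K * (2 * D) + (if s.onPath then D - s.depth else D + s.depth)
  else 1

/-- A port through which another fragment is reached, and the root of the tree there. -/
noncomputable def outEdge (s : VState) (inb : Inbox) : Option (ℕ × ℕ) :=
  if h : ∃ x : ℕ × ℕ, ∃ m, inb x.1 = some m ∧ m.1.root = x.2 ∧ x.2 ≠ s.root then some h.choose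
  else none

/-- The vertex or one of its children has depth at least `D`. -/
def Deep (D : ℕ) (s : VState) (inb : Inbox) : Prop :=
  D ≤ s.depth ∨ ∃ p m, inb p = some m ∧ m.1.par = some m.2 ∧ D ≤ m.1.depth

/-- First exchange: look for edges that leave the fragment. -/
noncomputable def probe (D : ℕ) (s : VState) (inb : Inbox) : VState :=
  let items := ((s.outEdge inb).map fun x => (s.id, x.2)).toFinset ∪
    if s.Deep D inb then {(0, 0)} else ∅
  { s with out := s.outEdge inb, sub := items, all := items }

/-- The items that arrive from the child behind a port. -/
noncomputable def fromChild (inb : Inbox) (p : ℕ) : Finset (ℕ × ℕ) :=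
  ((inb p).map fun m => if m.1.par = some m.2 then m.1.sub else ∅).getD ∅

/-- Convergecast: collect the items of the children. -/
noncomputable def gather (s : VState) (inb : Inbox) : VState :=
  let items := s.sub ∪ (Finset.range s.deg).biUnion (fromChild inb)
  { s with got := fromChild inb, sub := items, all := items }

/-- Broadcast: copy the items of the parent. -/
def spread (s : VState) (inb : Inbox) : VState :=
  { s with all := ((s.par.bind inb).map fun m => m.1.all).getD s.all }

/-- The parent of the vertex if the vertex that makes the proposal becomes the root. -/
noncomputable def reroot (s : VState) : Option ℕ :=
  if h : ∃ p, s.Proposes p then some h.choose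
  else if h : ∃ p z, s.pick = some z ∧ z ∈ s.got p then some h.choose
  else s.par

/-- Second exchange: tell the neighbours about proposals and colors. The item `(0, 0)` stands for a
proposal from a fragment of larger color, and `(0, 1)` for a proposal to one of smaller color. -/
noncomputable def propose (s : VState) (inb : Inbox) : VState :=
  let items : Finset (ℕ × ℕ) :=
    (if ∃ p m, inb p = some m ∧ m.1.Proposes m.2 ∧ s.hue < m.1.hue then {(0, 0)} else ∅) ∪
    (if ∃ p m, inb p = some m ∧ s.Proposes p ∧ m.1.hue < s.hue then {(0, 1)} else ∅)
  { s with
    done := decide (s.all = ∅)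
    sub := items
    all := items
    color := s.hue
    npar := s.reroot
    onPath := ∃ z, s.pick = some z ∧ z ∈ s.sub }

/-- Third exchange: tell the neighbours the round in which the vertex will speak. -/
noncomputable def arrange (D K : ℕ) (s : VState) (inb : Inbox) : VState :=
  { s with
    par := if s.Moves then s.npar else s.par
    time := s.slot D K
    ptime := if s.Moves then ((s.npar.bind inb).map fun m => m.1.slot D K).getD 0 else 0 }

/-- Broadcast of the new labels. -/
def relabel (s : VState) (inb : Inbox) : VState :=
  { s with
    root := ((s.par.bind inb).map fun m => m.1.root).getD s.root
    depth := ((s.par.bind inb).map fun m => m.1.depth + 1).getD s.depth }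

end VState

/-- A stage in which only vertices that are not done and satisfy `act` take part. -/
noncomputable def activeStage (len : ℕ) (act : VState → Prop) (listen speak : VState → ℕ)
    (upd : VState → Inbox → VState) : Stage VState :=
  open scoped Classical in
  { len := len
    listen := fun s => if s.done = false ∧ act s then listen s else len
    speak := fun s => if s.done = false ∧ act s then speak s else len
    upd := upd }

/-- A stage of one round in which all vertices send and receive. -/
noncomputable def exchangeStage (upd : VState → Inbox → VState) : Stage VState :=
  activeStage 1 (fun _ => True) (fun _ => 0) (fun _ => 0) upd

/-- The number of rounds that suffices for any stage. -/
def stageBound (D K : ℕ) : ℕ := (2 * K + 1) * (2 * D)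

/-- Convergecast in all trees, up to depth `D`. -/
noncomputable def gatherStage (D K : ℕ) : Stage VState :=
  activeStage (stageBound D K) (fun s => s.depth < D) (fun s => D - 1 - s.depth)
    (fun s => D - s.depth) VState.gather

/-- Broadcast in all trees, up to depth `D`. -/
noncomputable def spreadStage (D K : ℕ) : Stage VState :=
  activeStage (stageBound D K) (fun s => s.depth < D) (fun s => s.depth)
    (fun s => s.depth + 1) VState.spread

/-- Broadcast of the new labels. -/
noncomputable def relabelStage (D K : ℕ) : Stage VState :=
  activeStage (stageBound D K) (fun _ => True) (fun s => s.ptime) (fun s => s.time) VState.relabel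

/-- The eight stages of a phase in which fragments of depth less than `D` merge; the colors are at
most `K`. -/
noncomputable def phaseStage (D K : ℕ) : ℕ → Stage VState
  | 0 => exchangeStage (VState.probe D)
  | 1 => gatherStage D K
  | 2 => spreadStage D K
  | 3 => exchangeStage VState.propose
  | 4 => gatherStage D K
  | 5 => spreadStage D K
  | 6 => exchangeStage (VState.arrange D K)
  | _ => relabelStage D K

/-- The bound on the colors. -/
def maxColor (nhat : ℕ) : ℕ := 2 * (Nat.log 2 nhat + 1)

/-- The sequence of all stages. -/
noncomputable def dltPlan (nhat i : ℕ) : Stage VState :=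
  phaseStage (2 ^ (i / 8 + 1)) (maxColor nhat) (i % 8)

/-- At the beginning, every vertex is the root of a tree without edges. -/
def dltInit (_ i d : ℕ) : VState where
  id := i
  deg := d
  root := i
  depth := 0
  par := none
  done := false
  out := none
  sub := ∅
  got := fun _ => ∅
  all := ∅
  color := 0
  npar := none
  onPath := False
  time := 0
  ptime := 0

/-- The output of a vertex. -/
def dltOutput (s : VState) : DLTOutput (ℕ ×ₗ ℕ) where
  label := toLex (s.root, s.depth)
  parent := s.par.map fun p => (p, toLex (s.root, s.depth - 1))

/-! ### Lengths and schedules of the stages -/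

theorem stageBound_pos {D K : ℕ} (hD : 0 < D) : 0 < stageBound D K := by
  unfold stageBound; positivity

theorem lt_stageBound {D K : ℕ} (hD : 0 < D) : D < stageBound D K := by
  unfold stageBound; nlinarith [Nat.zero_le (K * D)]

theorem phaseStage_len_pos {D K : ℕ} (hD : 0 < D) (j : ℕ) : 0 < (phaseStage D K j).len := by
  unfold phaseStage
  split <;> first | exact Nat.one_pos | exact stageBound_pos hD

theorem phaseStage_len_le {D K : ℕ} (hD : 0 < D) (j : ℕ) :
    (phaseStage D K j).len ≤ stageBound D K := by
  unfold phaseStage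
  split <;> first | exact stageBound_pos hD | exact le_rfl

theorem activeStage_steady {len : ℕ} {act : VState → Prop} {listen speak : VState → ℕ}
    {upd : VState → Inbox → VState} (hd : ∀ s inb, (upd s inb).done = s.done)
    (ha : ∀ s inb, act (upd s inb) ↔ act s) (hl : ∀ s inb, listen (upd s inb) = listen s)
    (hs : ∀ s inb, speak (upd s inb) = speak s) :
    (activeStage len act listen speak upd).Steady := by
  intro s inb _
  simp only [activeStage, hl, hs]
  have hd' := hd s inb
  have ha' := ha s inb
  constructor <;> congr! 2 <;> simp [hd']

/-- Vacuous, as no round follows the listening round. This allows `VState.propose` to set `done`, on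
which the schedule depends. -/
theorem exchangeStage_steady (upd : VState → Inbox → VState) : (exchangeStage upd).Steady := by
  intro s inb h
  change _ + 1 < 1 at h
  omega

theorem phaseStage_steady (D K j : ℕ) : (phaseStage D K j).Steady := by
  unfold phaseStage
  split <;> first
    | exact exchangeStage_steady _
    | exact activeStage_steady (fun _ _ => rfl) (fun _ _ => Iff.rfl) (fun _ _ => rfl)
        (fun _ _ => rfl)

/-! ### Stages of the algorithm as steps -/

section Steps

variable {V : Type*} {N : Network V} {σ σ' : V → VState}

theorem exchange_step {upd : VState → Inbox → VState}
    (h : StageStep N (exchangeStage upd) σ σ') (hd : ∀ v, (σ v).done = false) (v : V) :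
    σ' v = upd (σ v) (inboxOf N (fun _ u => some (σ u)) v) := by
  rw [h v]
  simp [exchangeStage, activeStage, hd]

/-- Active vertices listen before they speak, so every message is the sender's state after the
stage. Inactive vertices have speaking round `len`, which no listening round in range equals. -/
theorem active_step {len : ℕ} {act : VState → Prop} [DecidablePred act] {listen speak : VState → ℕ}
    {upd : VState → Inbox → VState} (h : StageStep N (activeStage len act listen speak upd) σ σ')
    (hd : ∀ v, (σ v).done = false) (hlt : ∀ v, act (σ v) → listen (σ v) < speak (σ v)) (v : V)
    (hv : act (σ v)) (hv' : listen (σ v) < len) :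
    σ' v = upd (σ v) (inboxOf N (fun v u =>
      if act (σ u) ∧ speak (σ u) = listen (σ v) then some (σ' u) else none) v) := by
  rw [h v]
  simp only [activeStage, hd, true_and, hv, if_true, hv']
  congr 1
  funext p
  unfold inboxOf
  split_ifs with hp
  · congr 1
    generalize (N.port v ⟨p, hp⟩ : V) = u
    by_cases hu : act (σ u)
    · simp [hu, hv, hlt u hu]
    · simp [hu, hv, hv'.ne']
  · rfl

theorem inactive_step {len : ℕ} {act : VState → Prop} {listen speak : VState → ℕ}
    {upd : VState → Inbox → VState} (h : StageStep N (activeStage len act listen speak upd) σ σ')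
    (v : V) (hv : ¬ ((σ v).done = false ∧ act (σ v))) : σ' v = σ v := by
  rw [h v]
  simp [activeStage, hv]

end Steps

/-! ### Labelled forests -/

/-- The pointers to the parents form a forest in the network, and the vertices know the identifiers
of the roots and their depths. -/
structure IsForest {V : Type*} (N : Network V) (κ : V → Core) : Prop where
  id_eq : ∀ v, (κ v).id = N.ident v
  deg_eq : ∀ v, (κ v).deg = N.deg v
  label : ∀ v, ((κ v).par = none ∧ (κ v).depth = 0 ∧ (κ v).root = N.ident v) ∨
    ∃ q u q', (κ v).par = some q ∧ N.Link v q u q' ∧ (κ v).root = (κ u).root ∧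
      (κ v).depth = (κ u).depth + 1

namespace IsForest

variable {V : Type*} {N : Network V} {κ : V → Core} (hF : IsForest N κ)
include hF

theorem of_par_none {v : V} (h : (κ v).par = none) :
    (κ v).depth = 0 ∧ (κ v).root = N.ident v := by
  rcases hF.label v with h' | ⟨q, u, q', h', -⟩
  · exact h'.2
  · rw [h] at h'; exact absurd h' (by simp)

theorem of_par_some {v u : V} {q q' : ℕ} (h : (κ v).par = some q) (hl : N.Link v q u q') :
    (κ v).root = (κ u).root ∧ (κ v).depth = (κ u).depth + 1 := by
  rcases hF.label v with h' | ⟨p, w, p', h', hl', h''⟩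
  · rw [h'.1] at h; exact absurd h (by simp)
  · rw [h] at h'
    obtain rfl : q = p := by simpa using h'
    obtain ⟨rfl, rfl⟩ := hl.unique hl'
    exact h''

theorem exists_parent {v : V} {q : ℕ} (h : (κ v).par = some q) : ∃ u q', N.Link v q u q' := by
  rcases hF.label v with h' | ⟨p, w, p', h', hl', h''⟩
  · rw [h'.1] at h; exact absurd h (by simp)
  · rw [h] at h'
    obtain rfl : q = p := by simpa using h'
    exact ⟨_, _, hl'⟩

/-- Depths drop by one towards the parent, so the pointers cannot cycle and induction on the depth
applies. -/
theorem induction {P : V → Prop} (root : ∀ v, (κ v).par = none → P v)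
    (step : ∀ v q u q', (κ v).par = some q → N.Link v q u q' → P u → P v) (v : V) : P v := by
  induction hn : (κ v).depth generalizing v with
  | zero =>
    rcases hF.label v with h' | ⟨p, w, p', h', hl', h''⟩
    · exact root v h'.1
    · omega
  | succ n ih =>
    rcases hF.label v with h' | ⟨p, w, p', h', hl', h''⟩
    · exact root v h'.1
    · exact step v p w p' h' hl' (ih w (by omega))

theorem exists_root (v : V) : ∃ r, (κ r).par = none ∧ (κ r).root = (κ v).root := by
  induction v using hF.induction with
  | root v h => exact ⟨v, h, rfl⟩
  | step v q u q' h hl ih =>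
    obtain ⟨r, h1, h2⟩ := ih
    exact ⟨r, h1, h2.trans (hF.of_par_some h hl).1.symm⟩

theorem root_unique {r s : V} (hr : (κ r).par = none) (hs : (κ s).par = none)
    (h : (κ r).root = (κ s).root) : r = s := by
  rw [(hF.of_par_none hr).2, (hF.of_par_none hs).2] at h
  exact N.ident_injective h

theorem exists_ancestor (v : V) (j : ℕ) (hj : j ≤ (κ v).depth) :
    ∃ u, (κ u).root = (κ v).root ∧ (κ u).depth = j := by
  induction v using hF.induction with
  | root v h =>
    have := (hF.of_par_none h).1
    exact ⟨v, rfl, by omega⟩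
  | step v q u q' h hl ih =>
    obtain ⟨e1, e2⟩ := hF.of_par_some h hl
    rcases Nat.lt_or_ge (κ u).depth j with h' | h'
    · exact ⟨v, rfl, by omega⟩
    · obtain ⟨w, hw, hw'⟩ := ih h'
      exact ⟨w, hw.trans e1.symm, hw'⟩

end IsForest

/-! ### Convergecast and broadcast -/

/-- The effect of a convergecast and a broadcast up to depth `D` that lead from `σ` to `σ'`. -/
structure Shared {V : Type*} (N : Network V) (κ : V → Core) (D : ℕ) (σ σ' : V → VState) : Prop where
  core : ∀ v, (σ' v).toCore = κ v
  done : ∀ v, (σ' v).done = (σ v).done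
  out : ∀ v, (σ' v).out = (σ v).out
  color : ∀ v, (σ' v).color = (σ v).color
  npar : ∀ v, (σ' v).npar = (σ v).npar
  onPath : ∀ v, (σ' v).onPath = (σ v).onPath
  sub_mono : ∀ v, (κ v).depth < D → (σ v).sub ⊆ (σ' v).sub
  sub_parent : ∀ v q u q', (κ v).depth < D → (κ v).par = some q → N.Link v q u q' →
    (σ' v).sub ⊆ (σ' u).sub
  sub_source : ∀ v z, (κ v).depth < D → z ∈ (σ' v).sub →
    z ∈ (σ v).sub ∨ ∃ p, z ∈ (σ' v).got p
  got_source : ∀ v p z, (κ v).depth < D → z ∈ (σ' v).got p →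
    ∃ c q, N.Link v p c q ∧ (κ c).par = some q ∧ (κ c).depth < D ∧ z ∈ (σ' c).sub
  all_root : ∀ v, (κ v).depth < D → (κ v).par = none → (σ' v).all = (σ' v).sub
  all_parent : ∀ v q u q', (κ v).depth < D → (κ v).par = some q → N.Link v q u q' →
    (σ' v).all = (σ' u).all
  all_deep : ∀ v, D ≤ (κ v).depth → (σ' v).all = (σ v).all

section Share

variable {V : Type*} {N : Network V} {κ : V → Core} {σ₀ σ₁ σ₂ : V → VState} {D K : ℕ}

/-- The schedules match: a vertex of depth `d` listens in round `D - 1 - d` of the convergecast,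
when depth `d + 1` speaks, and in round `d` of the broadcast, when depth `d - 1` speaks. -/
theorem shared_of_steps (hF : IsForest N κ) (hκ : ∀ v, (σ₀ v).toCore = κ v)
    (hd : ∀ v, (σ₀ v).done = false) (hg : StageStep N (gatherStage D K) σ₀ σ₁)
    (hs : StageStep N (spreadStage D K) σ₁ σ₂) : Shared N κ D σ₀ σ₂ := by
  classical
  -- the convergecast
  have g0 : ∀ v, ¬ (κ v).depth < D → σ₁ v = σ₀ v := fun v hv =>
    inactive_step hg v (by rw [hκ]; tauto)
  have lb : ∀ {d}, d < D → D < stageBound D K := fun h => lt_stageBound (by omega)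
  have g1 : ∀ v, (κ v).depth < D → σ₁ v = (σ₀ v).gather (inboxOf N (fun v u =>
      if (σ₀ u).depth < D ∧ D - (σ₀ u).depth = D - 1 - (σ₀ v).depth then some (σ₁ u) else none) v) :=
    fun v hv => active_step hg hd (fun v (hv : (σ₀ v).depth < D) => by omega) v
      (by rw [hκ]; exact hv) (by have := lb hv; omega)
  have hg' : ∀ v, (σ₁ v).toCore = κ v ∧ (σ₁ v).done = (σ₀ v).done ∧ (σ₁ v).out = (σ₀ v).out ∧
      (σ₁ v).color = (σ₀ v).color ∧ (σ₁ v).npar = (σ₀ v).npar ∧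
      (σ₁ v).onPath = (σ₀ v).onPath := by
    intro v
    by_cases hv : (κ v).depth < D
    · rw [g1 v hv]; exact ⟨hκ v, rfl, rfl, rfl, rfl, rfl⟩
    · rw [g0 v hv]; exact ⟨hκ v, rfl, rfl, rfl, rfl, rfl⟩
  have hd1 : ∀ v, (σ₁ v).done = false := fun v => (hg' v).2.1.trans (hd v)
  have hκ1 : ∀ v, (σ₁ v).toCore = κ v := fun v => (hg' v).1
  -- the broadcast
  have s0 : ∀ v, ¬ (κ v).depth < D → σ₂ v = σ₁ v := fun v hv =>
    inactive_step hs v (by rw [hκ1]; tauto)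
  have s1 : ∀ v, (κ v).depth < D → σ₂ v = (σ₁ v).spread (inboxOf N (fun v u =>
      if (σ₁ u).depth < D ∧ (σ₁ u).depth + 1 = (σ₁ v).depth then some (σ₂ u) else none) v) :=
    fun v hv => active_step hs hd1 (fun v (hv : (σ₁ v).depth < D) => by omega) v
      (by rw [hκ1]; exact hv) (by rw [hκ1]; have := lb hv; omega)
  have hs' : ∀ v, (σ₂ v).toCore = κ v ∧ (σ₂ v).done = (σ₁ v).done ∧ (σ₂ v).out = (σ₁ v).out ∧
      (σ₂ v).color = (σ₁ v).color ∧ (σ₂ v).npar = (σ₁ v).npar ∧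
      (σ₂ v).onPath = (σ₁ v).onPath ∧ (σ₂ v).sub = (σ₁ v).sub ∧ (σ₂ v).got = (σ₁ v).got := by
    intro v
    by_cases hv : (κ v).depth < D
    · rw [s1 v hv]; exact ⟨hκ1 v, rfl, rfl, rfl, rfl, rfl, rfl, rfl⟩
    · rw [s0 v hv]; exact ⟨hκ1 v, rfl, rfl, rfl, rfl, rfl, rfl, rfl⟩
  have sub1 : ∀ v, (σ₂ v).sub = (σ₁ v).sub := fun v => (hs' v).2.2.2.2.2.2.1
  have got1 : ∀ v, (σ₂ v).got = (σ₁ v).got := fun v => (hs' v).2.2.2.2.2.2.2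
  -- Neighbours that are not children may speak in the same round; only senders whose parent port is
  -- this very edge count.
  have hgot : ∀ v p z, (κ v).depth < D → (z ∈ (σ₁ v).got p ↔
      ∃ c q, N.Link v p c q ∧ (κ c).par = some q ∧ (κ c).depth < D ∧ z ∈ (σ₁ c).sub) := by
    intro v p z hv
    rw [g1 v hv]
    simp only [VState.gather, VState.fromChild]
    constructor
    · intro h
      cases hm : inboxOf N (fun v u => if (σ₀ u).depth < D ∧ D - (σ₀ u).depth = D - 1 - (σ₀ v).depth
        then some (σ₁ u) else none) v p with
      | none => simp [hm] at h
      | some m =>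
        rw [hm] at h
        simp only [Option.map_some, Option.getD_some] at h
        split_ifs at h with hp
        · obtain ⟨c, hl, hc⟩ := inboxOf_eq_some.1 hm
          split_ifs at hc with hc'
          have e : σ₁ c = m.1 := by simpa using hc
          rw [← e] at hp h
          rw [hκ1] at hp
          rw [hκ] at hc'
          exact ⟨c, m.2, hl, hp, hc'.1, h⟩
        · simp at h
    · rintro ⟨c, q, hl, hp, hc, hz⟩
      obtain ⟨-, e⟩ := hF.of_par_some hp hl.symm
      have : inboxOf N (fun v u => if (σ₀ u).depth < D ∧ D - (σ₀ u).depth = D - 1 - (σ₀ v).depth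
        then some (σ₁ u) else none) v p = some (σ₁ c, q) :=
        inboxOf_eq_some.2 ⟨c, hl, by rw [hκ, hκ, if_pos ⟨hc, by omega⟩]⟩
      rw [this]
      simp only [Option.map_some, Option.getD_some]
      rwa [hκ1, if_pos hp]
  have hsub : ∀ v z, (κ v).depth < D → (z ∈ (σ₁ v).sub ↔
      z ∈ (σ₀ v).sub ∨ ∃ p < N.deg v, z ∈ (σ₁ v).got p) := by
    intro v z hv
    rw [g1 v hv]
    simp only [VState.gather, Finset.mem_union, Finset.mem_biUnion, Finset.mem_range, hκ,
      hF.deg_eq]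
  have hall : ∀ v, (κ v).depth < D → (σ₁ v).all = (σ₁ v).sub := by
    intro v hv
    rw [g1 v hv]
    rfl
  constructor
  · exact fun v => (hs' v).1
  · exact fun v => (hs' v).2.1.trans (hg' v).2.1
  · exact fun v => (hs' v).2.2.1.trans (hg' v).2.2.1
  · exact fun v => (hs' v).2.2.2.1.trans (hg' v).2.2.2.1
  · exact fun v => (hs' v).2.2.2.2.1.trans (hg' v).2.2.2.2.1
  · exact fun v => (hs' v).2.2.2.2.2.1.trans (hg' v).2.2.2.2.2
  · intro v hv z hz
    rw [sub1]
    exact (hsub v z hv).2 (Or.inl hz)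
  · intro v q u q' hv hp hl z hz
    rw [sub1] at hz ⊢
    have hu := (hF.of_par_some hp hl).2
    have hu' : (κ u).depth < D := by omega
    exact (hsub u z hu').2 (Or.inr ⟨q', hl.symm.lt, (hgot u q' z hu').2 ⟨v, q, hl.symm, hp, hv, hz⟩⟩)
  · intro v z hv hz
    rw [sub1] at hz
    rw [got1]
    rcases (hsub v z hv).1 hz with h | ⟨p, -, h⟩
    · exact Or.inl h
    · exact Or.inr ⟨p, h⟩
  · intro v p z hv hz
    rw [got1] at hz
    simp only [sub1]
    exact (hgot v p z hv).1 hz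
  · intro v hv hp
    rw [sub1, ← hall v hv, s1 v hv]
    simp [VState.spread, hκ1, hp]
  · intro v q u q' hv hp hl
    have hu := (hF.of_par_some hp hl).2
    have : inboxOf N (fun v u => if (σ₁ u).depth < D ∧ (σ₁ u).depth + 1 = (σ₁ v).depth
        then some (σ₂ u) else none) v q = some (σ₂ u, q') :=
      inboxOf_eq_some.2 ⟨u, hl, by rw [hκ1, hκ1, if_pos ⟨by omega, by omega⟩]⟩
    rw [s1 v hv]
    simp only [VState.spread]
    rw [show (σ₁ v).par = some q by rw [hκ1]; exact hp, Option.bind_some, this]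
    rfl
  · intro v hv
    rw [s0 v (by omega), g0 v (by omega)]

namespace Shared

variable (hF : IsForest N κ) (hS : Shared N κ D σ₀ σ₁)
include hF hS

theorem all_eq_of_root {v r : V} (hv : (κ v).depth < D) (hr : (κ r).par = none)
    (h : (κ r).root = (κ v).root) : (σ₁ v).all = (σ₁ r).all := by
  induction v using hF.induction with
  | root v hp => rw [hF.root_unique hr hp h]
  | step v q u q' hp hl ih =>
    obtain ⟨e1, e2⟩ := hF.of_par_some hp hl
    rw [hS.all_parent v q u q' hv hp hl, ih (by omega) (h.trans e1)]

theorem all_eq {v w : V} (hv : (κ v).depth < D) (hw : (κ w).depth < D)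
    (h : (κ v).root = (κ w).root) : (σ₁ v).all = (σ₁ w).all := by
  obtain ⟨r, hr, hr'⟩ := hF.exists_root v
  rw [hS.all_eq_of_root hF hv hr hr', hS.all_eq_of_root hF hw hr (hr'.trans h)]

theorem sub_subset_all {v : V} (hv : (κ v).depth < D) : (σ₁ v).sub ⊆ (σ₁ v).all := by
  induction v using hF.induction with
  | root v hp => rw [hS.all_root v hv hp]
  | step v q u q' hp hl ih =>
    obtain ⟨e1, e2⟩ := hF.of_par_some hp hl
    rw [hS.all_parent v q u q' hv hp hl]
    exact (hS.sub_parent v q u q' hv hp hl).trans (ih (by omega))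

theorem mem_all {v w : V} {z : ℕ × ℕ} (hv : (κ v).depth < D) (hw : (κ w).depth < D)
    (h : (κ v).root = (κ w).root) (hz : z ∈ (σ₀ v).sub) : z ∈ (σ₁ w).all := by
  rw [← hS.all_eq hF hv hw h]
  exact hS.sub_subset_all hF hv (hS.sub_mono v hv hz)

/-- An item is traced to its source from child to child; the depth grows but stays below `D`, so the
descent ends. -/
theorem exists_of_mem_sub {v : V} {z : ℕ × ℕ} (hv : (κ v).depth < D) (hz : z ∈ (σ₁ v).sub) :
    ∃ u, (κ u).root = (κ v).root ∧ (κ u).depth < D ∧ z ∈ (σ₀ u).sub := by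
  induction hn : D - (κ v).depth generalizing v with
  | zero => omega
  | succ n ih =>
    rcases hS.sub_source v z hv hz with h | ⟨p, h⟩
    · exact ⟨v, rfl, hv, h⟩
    · obtain ⟨c, q, hl, hp, hc, h'⟩ := hS.got_source v p z hv h
      obtain ⟨e1, e2⟩ := hF.of_par_some hp hl.symm
      obtain ⟨u, h1, h2, h3⟩ := ih hc h' (by omega)
      exact ⟨u, h1.trans e1, h2, h3⟩

theorem exists_of_mem_all {v : V} {z : ℕ × ℕ} (hv : (κ v).depth < D) (hz : z ∈ (σ₁ v).all) :
    ∃ u, (κ u).root = (κ v).root ∧ (κ u).depth < D ∧ z ∈ (σ₀ u).sub := by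
  obtain ⟨r, hr, hr'⟩ := hF.exists_root v
  have hr0 : (κ r).depth < D := by rw [(hF.of_par_none hr).1]; omega
  rw [hS.all_eq_of_root hF hv hr hr', hS.all_root r hr0 hr] at hz
  obtain ⟨u, h1, h2⟩ := hS.exists_of_mem_sub hF hr0 hz
  exact ⟨u, h1.trans hr', h2⟩

end Shared

end Share

/-! ### The first half of a phase: fragments choose proposals -/

/-- The run of the stages of a phase, from the forest `κ`. -/
structure PhaseRun {V : Type*} (N : Network V) (D K : ℕ) (κ : V → Core) (σ : ℕ → V → VState) :
    Prop where
  depth_pos : 0 < D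
  ident_pos : ∀ v, 0 < N.ident v
  forest : IsForest N κ
  core : ∀ v, (σ 0 v).toCore = κ v
  fresh : ∀ v, (σ 0 v).done = false
  step : ∀ j < 8, StageStep N (phaseStage D K j) (σ j) (σ (j + 1))

section Probe

variable {V : Type*} {N : Network V} {σ : V → VState} {v : V}

theorem inboxOf_state_eq_some {p : ℕ} {m : VState × ℕ} :
    inboxOf N (fun _ u => some (σ u)) v p = some m ↔ ∃ u, N.Link v p u m.2 ∧ σ u = m.1 := by
  simp [inboxOf_eq_some]

theorem outEdge_eq_some {s : VState} {x : ℕ × ℕ}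
    (h : s.outEdge (inboxOf N (fun _ u => some (σ u)) v) = some x) :
    ∃ u q, N.Link v x.1 u q ∧ (σ u).root = x.2 ∧ x.2 ≠ s.root := by
  unfold VState.outEdge at h
  split_ifs at h with h'
  obtain ⟨m, h1, h2, h3⟩ := h'.choose_spec
  obtain rfl := Option.some.inj h
  obtain ⟨u, hl, hu⟩ := inboxOf_state_eq_some.1 h1
  exact ⟨u, m.2, hl, by rw [hu, h2], h3⟩

theorem root_eq_of_outEdge_eq_none {s : VState}
    (h : s.outEdge (inboxOf N (fun _ u => some (σ u)) v) = none) {u : V}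
    (hu : N.graph.Adj v u) : (σ u).root = s.root := by
  unfold VState.outEdge at h
  split_ifs at h with h'
  by_contra hne
  obtain ⟨p, q, hl⟩ := N.exists_link hu
  exact h' ⟨(p, (σ u).root), (σ u, q), inboxOf_state_eq_some.2 ⟨u, hl, rfl⟩, rfl, hne⟩

theorem deep_iff {D : ℕ} {s : VState} :
    s.Deep D (inboxOf N (fun _ u => some (σ u)) v) ↔
      D ≤ s.depth ∨ ∃ p c q, N.Link v p c q ∧ (σ c).par = some q ∧ D ≤ (σ c).depth := by
  unfold VState.Deep
  refine or_congr Iff.rfl ⟨?_, ?_⟩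
  · rintro ⟨p, m, h1, h2, h3⟩
    obtain ⟨u, hl, hu⟩ := inboxOf_state_eq_some.1 h1
    exact ⟨p, u, m.2, hl, by rw [hu, h2], by rw [hu]; exact h3⟩
  · rintro ⟨p, c, q, hl, h2, h3⟩
    exact ⟨p, (σ c, q), inboxOf_state_eq_some.2 ⟨c, hl, rfl⟩, h2, h3⟩

theorem mem_probe {D : ℕ} {s : VState} {inb : Inbox} {z : ℕ × ℕ} :
    z ∈ (s.probe D inb).sub ↔
      (∃ x, s.outEdge inb = some x ∧ z = (s.id, x.2)) ∨ (s.Deep D inb ∧ z = (0, 0)) := by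
  unfold VState.probe
  simp only [Finset.mem_union, Option.mem_toFinset, Option.mem_def, Option.map_eq_some_iff]
  refine or_congr ?_ ?_
  · simp only [eq_comm]
  · split_ifs with h <;> simp [h]

end Probe

theorem VState.pick_eq_some {s : VState} {z : ℕ × ℕ} (h : s.pick = some z) :
    z ∈ s.all ∧ (0, 0) ∉ s.all := by
  unfold VState.pick at h
  split_ifs at h with h'
  obtain rfl := Option.some.inj h
  exact ⟨h'.1.choose_spec, h'.2⟩

theorem VState.pick_eq_none {s : VState} (h : s.pick = none) (h' : s.all ≠ ∅) :
    (0, 0) ∈ s.all := by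
  unfold VState.pick at h
  split_ifs at h with h''
  by_contra hc
  exact h'' ⟨Finset.nonempty_iff_ne_empty.2 h', hc⟩

namespace PhaseRun

variable {V : Type*} {N : Network V} {D K : ℕ} {κ : V → Core} {σ : ℕ → V → VState}
  (hR : PhaseRun N D K κ σ)
include hR

theorem probed (v : V) :
    σ 1 v = (σ 0 v).probe D (inboxOf N (fun _ u => some (σ 0 u)) v) :=
  exchange_step (hR.step 0 (by norm_num)) hR.fresh v

theorem core_one (v : V) : (σ 1 v).toCore = κ v := by
  rw [hR.probed]; exact hR.core v

theorem shared : Shared N κ D (σ 1) (σ 3) :=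
  shared_of_steps hR.forest hR.core_one (fun v => by rw [hR.probed]; exact hR.fresh v)
    (hR.step 1 (by norm_num)) (hR.step 2 (by norm_num))

theorem core_three (v : V) : (σ 3 v).toCore = κ v := hR.shared.core v

theorem done_three (v : V) : (σ 3 v).done = false := by
  rw [hR.shared.done, hR.probed]; exact hR.fresh v

theorem exists_of_out {v : V} {x : ℕ × ℕ} (h : (σ 3 v).out = some x) :
    ∃ u q, N.Link v x.1 u q ∧ (κ u).root = x.2 ∧ x.2 ≠ (κ v).root := by
  rw [hR.shared.out, hR.probed] at h
  obtain ⟨u, q, h1, h2, h3⟩ := outEdge_eq_some h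
  rw [hR.core] at h2 h3
  exact ⟨u, q, h1, h2, h3⟩

theorem mem_sub_one {v : V} {z : ℕ × ℕ} : z ∈ (σ 1 v).sub ↔
    (∃ x, (σ 3 v).out = some x ∧ z = (N.ident v, x.2)) ∨
    ((D ≤ (κ v).depth ∨ ∃ p c q, N.Link v p c q ∧ (κ c).par = some q ∧ D ≤ (κ c).depth) ∧
      z = (0, 0)) := by
  rw [hR.shared.out, hR.probed, mem_probe, deep_iff]
  simp only [hR.core, hR.forest.id_eq]
  rfl

/-- A vertex too deep has an ancestor of depth exactly `D`, whose parent takes part in the waves and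
contributes `(0, 0)`. Vertices of depth at least `D` sleep through the waves but hold `(0, 0)` from
their own probe. -/
theorem small_of_notMem {v : V} (h : (0, 0) ∉ (σ 3 v).all) {u : V}
    (hu : (κ u).root = (κ v).root) : (κ u).depth < D := by
  have hv : (κ v).depth < D := by
    by_contra hv
    rw [not_lt] at hv
    apply h
    rw [hR.shared.all_deep v hv]
    have : (σ 1 v).all = (σ 1 v).sub := by rw [hR.probed]; rfl
    rw [this]
    exact hR.mem_sub_one.2 (Or.inr ⟨Or.inl hv, rfl⟩)
  by_contra hc
  rw [not_lt] at hc
  obtain ⟨w, hw, hw'⟩ := hR.forest.exists_ancestor u D hc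
  have hD := hR.depth_pos
  rcases hR.forest.label w with h' | ⟨q, x, q', h1, h2, h3, h4⟩
  · omega
  · exact h (hR.shared.mem_all hR.forest (v := x) (by omega) hv (h3.symm.trans (hw.trans hu))
      (hR.mem_sub_one.2 (Or.inr ⟨Or.inr ⟨q', w, q, h2.symm, h1, hw'.ge⟩, rfl⟩)))

theorem all_eq_of_notMem {v : V} (h : (0, 0) ∉ (σ 3 v).all) {u : V}
    (hu : (κ u).root = (κ v).root) : (σ 3 u).all = (σ 3 v).all :=
  hR.shared.all_eq hR.forest (hR.small_of_notMem h hu) (hR.small_of_notMem h rfl) hu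

/-- The choice depends only on the set `all`, which is common to a shallow fragment, so its members
agree without further messages; in a deep one nobody picks. -/
theorem pick_eq {u v : V} (hu : (κ u).root = (κ v).root) : (σ 3 u).pick = (σ 3 v).pick := by
  by_cases h : (0, 0) ∈ (σ 3 v).all
  · by_cases h' : (0, 0) ∈ (σ 3 u).all
    · simp [VState.pick, h, h']
    · exact absurd (hR.all_eq_of_notMem h' hu.symm ▸ h) h'
  · simp only [VState.pick, hR.all_eq_of_notMem h hu]

theorem hue_eq {u v : V} (hu : (κ u).root = (κ v).root) : (σ 3 u).hue = (σ 3 v).hue := by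
  unfold VState.hue
  rw [hR.pick_eq hu, hR.core_three, hR.core_three, hu]

/-- A fragment without items is the whole network. -/
theorem root_eq_of_all_eq_empty (hc : N.graph.Connected) {v : V} (h : (σ 3 v).all = ∅) (u : V) :
    (κ u).root = (κ v).root := by
  have key : ∀ x y, N.graph.Adj x y → (κ x).root = (κ v).root → (κ y).root = (κ v).root := by
    intro x y hxy hx
    have h0 : (0, 0) ∉ (σ 3 v).all := by simp [h]
    have hout : (σ 3 x).out = none := by
      -- An outgoing edge at `x` would have put an item into the empty set `all`.
      by_contra hne
      obtain ⟨e, he⟩ := Option.ne_none_iff_exists'.1 hne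
      have := hR.shared.mem_all hR.forest (hR.small_of_notMem h0 hx) (hR.small_of_notMem h0 rfl)
        hx (hR.mem_sub_one.2 (Or.inl ⟨e, he, rfl⟩))
      simp [h] at this
    rw [hR.shared.out, hR.probed] at hout
    have := root_eq_of_outEdge_eq_none hout hxy
    rw [hR.core, hR.core] at this
    exact this.trans hx
  obtain ⟨w⟩ := hc.preconnected v u
  have : ∀ {x y : V} (_ : N.graph.Walk x y), (κ x).root = (κ v).root → (κ y).root = (κ v).root := by
    intro x y w
    induction w with
    | nil => exact id
    | cons hxy _ ih => exact fun hx => ih (key _ _ hxy hx)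
  exact this w rfl

/-- A fragment that holds the item `(0, 0)` is deep. -/
theorem exists_deep {v : V} (h : (0, 0) ∈ (σ 3 v).all) :
    ∃ u, (κ u).root = (κ v).root ∧ D ≤ (κ u).depth := by
  by_cases hv : (κ v).depth < D
  · obtain ⟨u, hu, -, hu'⟩ := hR.shared.exists_of_mem_all hR.forest hv h
    rcases hR.mem_sub_one.1 hu' with ⟨x, -, hx⟩ | ⟨h' | ⟨p, c, q, hl, hc, hc'⟩, -⟩
    -- Identifiers are positive, so an edge item is never the marker `(0, 0)`.
    · have := hR.ident_pos u
      rw [Prod.mk.injEq] at hx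
      omega
    · exact ⟨u, hu, h'⟩
    · exact ⟨c, (hR.forest.of_par_some hc hl.symm).1.trans hu, hc'⟩
  · exact ⟨v, rfl, not_lt.1 hv⟩

/-- The vertex `a` proposes to `b` in the name of its fragment. -/
theorem exists_of_proposes {a : V} {p : ℕ} (h : (σ 3 a).Proposes p) :
    ∃ b q z, N.Link a p b q ∧ (σ 3 a).pick = some z ∧ z.1 = N.ident a ∧ z.2 = (κ b).root ∧
      (κ b).root ≠ (κ a).root := by
  obtain ⟨z, x, h1, h2, h3, rfl⟩ := h
  obtain ⟨h4, h5⟩ := VState.pick_eq_some h1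
  obtain ⟨u, hu, -, hu'⟩ :=
    hR.shared.exists_of_mem_all hR.forest (hR.small_of_notMem h5 rfl) h4
  rcases hR.mem_sub_one.1 hu' with ⟨y, hy, hy'⟩ | ⟨-, rfl⟩
  · rw [hR.core_three, hR.forest.id_eq] at h2
    obtain rfl : u = a := N.ident_injective (by rw [← h2, hy'])
    obtain rfl : y = x := by rw [hy] at h3; simpa using h3
    obtain ⟨b, q, hl, hb, hb'⟩ := hR.exists_of_out hy
    exact ⟨b, q, z, hl, h1, h2, by rw [hy', hb], by rw [hb]; exact hb'⟩
  · exact absurd h4 h5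

theorem exists_proposes {v : V} {z : ℕ × ℕ} (h : (σ 3 v).pick = some z) :
    ∃ a p, (κ a).root = (κ v).root ∧ (σ 3 a).Proposes p := by
  obtain ⟨h4, h5⟩ := VState.pick_eq_some h
  obtain ⟨u, hu, -, hu'⟩ :=
    hR.shared.exists_of_mem_all hR.forest (hR.small_of_notMem h5 rfl) h4
  rcases hR.mem_sub_one.1 hu' with ⟨y, hy, hy'⟩ | ⟨-, rfl⟩
  · exact ⟨u, y.1, hu, z, y, by rw [hR.pick_eq hu, h],
      by rw [hy', hR.core_three, hR.forest.id_eq], hy, rfl⟩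
  · exact absurd h4 h5

/-- The common pick names the proposer by its identifier, and each vertex remembers only one
outgoing port. -/
theorem proposes_unique {a a' : V} {p p' : ℕ} (h : (σ 3 a).Proposes p) (h' : (σ 3 a').Proposes p')
    (hr : (κ a).root = (κ a').root) : a = a' ∧ p = p' := by
  obtain ⟨z, x, h1, h2, h3, rfl⟩ := h
  obtain ⟨z', x', h1', h2', h3', rfl⟩ := h'
  rw [hR.core_three, hR.forest.id_eq] at h2 h2'
  rw [hR.pick_eq hr, h1'] at h1
  obtain rfl := Option.some.inj h1
  obtain rfl : a = a' := N.ident_injective (h2.symm.trans h2')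
  rw [h3] at h3'
  obtain rfl := Option.some.inj h3'
  exact ⟨rfl, rfl⟩

theorem hue_of_pick {v : V} {z : ℕ × ℕ} (h : (σ 3 v).pick = some z) :
    (σ 3 v).hue = coinToss (κ v).root z.2 + 1 := by
  simp [VState.hue, h, hR.core_three]

/-- If the target proposes as well, the roots `x ≠ y ≠ z` along the two proposals give different
coin tosses. If it does not, its color is `0`, which the shift by one excludes for a proposing
fragment. -/
theorem hue_ne {a b : V} {p q : ℕ} (h : (σ 3 a).Proposes p) (hl : N.Link a p b q) :
    (σ 3 a).hue ≠ (σ 3 b).hue := by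
  obtain ⟨b', q', z, hl', h1, h2, h3, h4⟩ := hR.exists_of_proposes h
  obtain ⟨rfl, rfl⟩ := hl.unique hl'
  rw [hR.hue_of_pick h1]
  cases hb : (σ 3 b).pick with
  | none => simp [VState.hue, hb]
  | some z' =>
    rw [hR.hue_of_pick hb, h3]
    obtain ⟨a', p', h5, h6⟩ := hR.exists_proposes hb
    obtain ⟨b', q', z'', -, h7, -, h9, h10⟩ := hR.exists_of_proposes h6
    rw [hR.pick_eq h5, hb] at h7
    obtain rfl := Option.some.inj h7
    intro hc
    exact coinToss_ne (z := z'.2) h4.symm (by rw [h9, ← h5]; exact h10.symm) (by omega)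

theorem hue_le {m : ℕ} (hm : ∀ v, N.ident v ≤ m) (v : V) : (σ 3 v).hue ≤ maxColor m := by
  have hroot : ∀ v, (κ v).root ≤ m := by
    intro v
    obtain ⟨r, h1, h2⟩ := hR.forest.exists_root v
    rw [← h2, (hR.forest.of_par_none h1).2]
    exact hm r
  cases hb : (σ 3 v).pick with
  | none => simp [VState.hue, hb]
  | some z =>
    rw [hR.hue_of_pick hb]
    obtain ⟨a', p', h5, h6⟩ := hR.exists_proposes hb
    obtain ⟨b', q', z'', -, h7, -, h9, h10⟩ := hR.exists_of_proposes h6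
    rw [hR.pick_eq h5, hb] at h7
    obtain rfl := Option.some.inj h7
    -- The strict bound on `coinToss` absorbs the shift by one.
    exact coinToss_lt (hroot v) (by rw [h9]; exact hroot b')

end PhaseRun

/-! ### The second half of a phase: fragments merge -/

theorem VState.mem_propose {s : VState} {inb : Inbox} {z : ℕ × ℕ} :
    z ∈ (s.propose inb).sub ↔
      ((∃ p m, inb p = some m ∧ m.1.Proposes m.2 ∧ s.hue < m.1.hue) ∧ z = (0, 0)) ∨
      ((∃ p m, inb p = some m ∧ s.Proposes p ∧ m.1.hue < s.hue) ∧ z = (0, 1)) := by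
  unfold VState.propose
  simp only [Finset.mem_union]
  refine or_congr ?_ ?_ <;> split_ifs with h <;>
    simp only [h, true_and, false_and, Finset.mem_singleton, Finset.notMem_empty]

/-- For depths below `D`, both `D - depth` and `D + depth` lie strictly between `0` and `2 * D`, so
different ranks use disjoint windows. -/
theorem VState.slot_of_moves {s : VState} {D K : ℕ} (h : s.Moves) (hd : s.depth < D) :
    s.rank K * (2 * D) < s.slot D K ∧ s.slot D K < s.rank K * (2 * D) + 2 * D := by
  unfold VState.slot
  rw [if_pos h]
  split_ifs <;> omega

theorem VState.reroot_eq_of_proposes {s : VState} {p : ℕ} (h : s.Proposes p) :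
    s.reroot = some p := by
  have h' : ∃ p, s.Proposes p := ⟨p, h⟩
  unfold VState.reroot
  rw [dif_pos h']
  have h1 := h'.choose_spec
  generalize h'.choose = p' at h1
  obtain ⟨z, x, -, -, h2, rfl⟩ := h
  obtain ⟨z', x', -, -, h2', rfl⟩ := h1
  rw [h2] at h2'
  rw [Option.some.inj h2']

namespace PhaseRun

variable {V : Type*} {N : Network V} {D K : ℕ} {κ : V → Core} {σ : ℕ → V → VState}
  (hR : PhaseRun N D K κ σ)
include hR

theorem proposed (v : V) :
    σ 4 v = (σ 3 v).propose (inboxOf N (fun _ u => some (σ 3 u)) v) :=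
  exchange_step (hR.step 3 (by norm_num)) hR.done_three v

theorem core_four (v : V) : (σ 4 v).toCore = κ v := by
  rw [hR.proposed]; exact hR.core_three v

theorem done_four (v : V) : (σ 4 v).done = decide ((σ 3 v).all = ∅) := by
  rw [hR.proposed]; unfold VState.propose; congr!

theorem mem_sub_four {v : V} {z : ℕ × ℕ} : z ∈ (σ 4 v).sub ↔
    ((∃ p a q, N.Link v p a q ∧ (σ 3 a).Proposes q ∧ (σ 3 v).hue < (σ 3 a).hue) ∧ z = (0, 0)) ∨
    ((∃ p b q, N.Link v p b q ∧ (σ 3 v).Proposes p ∧ (σ 3 b).hue < (σ 3 v).hue) ∧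
      z = (0, 1)) := by
  rw [hR.proposed, VState.mem_propose]
  refine or_congr (and_congr_left' (exists_congr fun p => ?_))
    (and_congr_left' (exists_congr fun p => ?_))
  · constructor
    · rintro ⟨m, h1, h2, h3⟩
      obtain ⟨u, hl, hu⟩ := inboxOf_state_eq_some.1 h1
      exact ⟨u, m.2, hl, by rw [hu]; exact h2, by rw [hu]; exact h3⟩
    · rintro ⟨a, q, hl, h2, h3⟩
      exact ⟨(σ 3 a, q), inboxOf_state_eq_some.2 ⟨a, hl, rfl⟩, h2, h3⟩
  · constructor
    · rintro ⟨m, h1, h2, h3⟩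
      obtain ⟨u, hl, hu⟩ := inboxOf_state_eq_some.1 h1
      exact ⟨u, m.2, hl, h2, by rw [hu]; exact h3⟩
    · rintro ⟨a, q, hl, h2, h3⟩
      exact ⟨(σ 3 a, q), inboxOf_state_eq_some.2 ⟨a, hl, rfl⟩, h2, h3⟩

variable (hne : ∀ v, (σ 3 v).all ≠ ∅)
include hne

theorem shared' : Shared N κ D (σ 4) (σ 6) :=
  shared_of_steps hR.forest hR.core_four (fun v => by rw [hR.done_four]; simp [hne v])
    (hR.step 4 (by norm_num)) (hR.step 5 (by norm_num))

theorem core_six (v : V) : (σ 6 v).toCore = κ v := (hR.shared' hne).core v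

theorem done_six (v : V) : (σ 6 v).done = false := by
  rw [(hR.shared' hne).done, hR.done_four]; simp [hne v]

theorem color_six (v : V) : (σ 6 v).color = (σ 3 v).hue := by
  rw [(hR.shared' hne).color, hR.proposed]; rfl

theorem npar_six (v : V) : (σ 6 v).npar = (σ 3 v).reroot := by
  rw [(hR.shared' hne).npar, hR.proposed]; rfl

theorem onPath_six (v : V) :
    (σ 6 v).onPath ↔ ∃ z, (σ 3 v).pick = some z ∧ z ∈ (σ 3 v).sub := by
  rw [(hR.shared' hne).onPath, hR.proposed]; rfl

/-- Only the unique proposer of the fragment can contribute `(0, 1)`, so this item tells all members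
whether their proposal goes down. -/
theorem down_mem_iff {a b v : V} {p q : ℕ} (h : (σ 3 a).Proposes p) (hl : N.Link a p b q)
    (hv : (κ v).root = (κ a).root) :
    (0, 1) ∈ (σ 6 v).all ↔ (σ 3 b).hue < (σ 3 a).hue := by
  have h' := h
  obtain ⟨z, x, h1, -⟩ := h'
  have h0 := (VState.pick_eq_some h1).2
  constructor
  · intro hm
    obtain ⟨u, hu, -, hu'⟩ :=
      (hR.shared' hne).exists_of_mem_all hR.forest (hR.small_of_notMem h0 hv) hm
    rcases hR.mem_sub_four.1 hu' with ⟨-, hz⟩ | ⟨⟨p', b', q', hl', hp', hlt⟩, -⟩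
    · simp at hz
    · obtain ⟨rfl, rfl⟩ := hR.proposes_unique hp' h (hu.trans hv)
      obtain ⟨rfl, rfl⟩ := hl.unique hl'
      exact hlt
  · intro hlt
    exact (hR.shared' hne).mem_all hR.forest (hR.small_of_notMem h0 rfl)
      (hR.small_of_notMem h0 hv) hv.symm (hR.mem_sub_four.2 (Or.inr ⟨⟨p, b, q, hl, h, hlt⟩, rfl⟩))

theorem child_mem_iff {v : V} {z : ℕ × ℕ} (h : (σ 3 v).pick = some z) :
    (0, 0) ∈ (σ 6 v).all ↔ ∃ b p a q, (κ b).root = (κ v).root ∧ N.Link b p a q ∧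
      (σ 3 a).Proposes q ∧ (σ 3 b).hue < (σ 3 a).hue := by
  have h0 := (VState.pick_eq_some h).2
  constructor
  · intro hm
    obtain ⟨u, hu, -, hu'⟩ :=
      (hR.shared' hne).exists_of_mem_all hR.forest (hR.small_of_notMem h0 rfl) hm
    rcases hR.mem_sub_four.1 hu' with ⟨⟨p, a, q, h1⟩, -⟩ | ⟨-, hz⟩
    · exact ⟨u, p, a, q, hu, h1⟩
    · simp at hz
  · rintro ⟨b, p, a, q, hb, h1⟩
    exact (hR.shared' hne).mem_all hR.forest (hR.small_of_notMem h0 hb)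
      (hR.small_of_notMem h0 rfl) hb (hR.mem_sub_four.2 (Or.inl ⟨⟨p, a, q, h1⟩, rfl⟩))

theorem exists_pick_of_moves {v : V} (h : (σ 6 v).Moves) : ∃ z, (σ 3 v).pick = some z := by
  have h1 := h.1
  rw [hR.color_six hne] at h1
  by_contra hc
  have : (σ 3 v).pick = none := by
    rw [← Option.not_isSome_iff_eq_none, Option.isSome_iff_exists]; exact hc
  simp [VState.hue, this] at h1

theorem depth_lt_of_moves {v : V} (h : (σ 6 v).Moves) : (κ v).depth < D := by
  obtain ⟨z, hz⟩ := hR.exists_pick_of_moves hne h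
  exact hR.small_of_notMem (VState.pick_eq_some hz).2 rfl

theorem moves_of_root {u v : V} (hu : (κ u).root = (κ v).root) (h : (σ 6 v).Moves) :
    (σ 6 u).Moves ∧ (σ 6 u).rank K = (σ 6 v).rank K := by
  obtain ⟨z, hz⟩ := hR.exists_pick_of_moves hne h
  have h0 := (VState.pick_eq_some hz).2
  have h1 := (hR.shared' hne).all_eq hR.forest (hR.small_of_notMem h0 hu)
    (hR.small_of_notMem h0 rfl) hu
  have h2 : (σ 6 u).color = (σ 6 v).color := by
    rw [hR.color_six hne, hR.color_six hne, hR.hue_eq hu]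
  unfold VState.Moves VState.rank at *
  rw [h1, h2]
  exact ⟨h, rfl⟩

/-- Round `0` stays silent; it is the listening round of the vertices that do not move. -/
theorem slot_pos (v : V) : 0 < (σ 6 v).slot D K := by
  by_cases h : (σ 6 v).Moves
  · have := (VState.slot_of_moves (K := K) h
      (by rw [hR.core_six hne]; exact hR.depth_lt_of_moves hne h)).1
    omega
  · simp [VState.slot, h]

theorem arranged (v : V) :
    σ 7 v = (σ 6 v).arrange D K (inboxOf N (fun _ u => some (σ 6 u)) v) :=
  exchange_step (hR.step 6 (by norm_num)) (hR.done_six hne) v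

theorem ptime_of_moves {v u : V} {p q : ℕ} (h : (σ 6 v).Moves) (hp : (σ 6 v).npar = some p)
    (hl : N.Link v p u q) : (σ 7 v).ptime = (σ 6 u).slot D K := by
  have : inboxOf N (fun _ u => some (σ 6 u)) v p = some (σ 6 u, q) :=
    inboxOf_state_eq_some.2 ⟨u, hl, rfl⟩
  rw [hR.arranged hne]
  simp [VState.arrange, h, hp, this]

theorem done_seven (v : V) : (σ 7 v).done = false := by
  rw [hR.arranged hne]; exact hR.done_six hne v

variable (hK : ∀ v, (σ 3 v).hue ≤ K)
include hK

/-- Downward proposals get ranks in `1, …, K` and upward ones in `K + 1, …, 2 * K`. The window of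
rank `0` is left to fragments that stay, which speak in round `1`. -/
theorem rank_pos {v : V} (h : (σ 6 v).Moves) : 0 < (σ 6 v).rank K ∧ (σ 6 v).rank K ≤ 2 * K := by
  have h1 := h.1
  have h2 := hK v
  rw [← hR.color_six hne] at h2
  unfold VState.rank
  split_ifs <;> omega

theorem slot_lt_stageBound (v : V) : (σ 6 v).slot D K < stageBound D K := by
  unfold stageBound
  have hD := hR.depth_pos
  by_cases h : (σ 6 v).Moves
  · refine (VState.slot_of_moves (K := K) h
      (by rw [hR.core_six hne]; exact hR.depth_lt_of_moves hne h)).2.trans_le ?_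
    have := Nat.mul_le_mul_right (2 * D) (hR.rank_pos hne hK h).2
    linarith
  · simp only [VState.slot, h, if_false]
    nlinarith [Nat.zero_le (K * D)]

theorem slot_lt_of_rank_lt {u v : V} (hv : (σ 6 v).Moves)
    (h : (σ 6 u).Moves → (σ 6 u).rank K < (σ 6 v).rank K) :
    (σ 6 u).slot D K < (σ 6 v).slot D K := by
  have h1 := (VState.slot_of_moves (K := K) hv
    (by rw [hR.core_six hne]; exact hR.depth_lt_of_moves hne hv)).1
  have hD := hR.depth_pos
  by_cases hu : (σ 6 u).Moves
  · have h2 := (VState.slot_of_moves (K := K) hu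
      (by rw [hR.core_six hne]; exact hR.depth_lt_of_moves hne hu)).2
    have := Nat.mul_le_mul_right (2 * D) (Nat.succ_le_of_lt (h hu))
    rw [Nat.succ_mul] at this
    omega
  · have := Nat.mul_le_mul_right (2 * D) (hR.rank_pos hne hK hv).1
    simp only [VState.slot, hu, if_false]
    simp only [VState.slot] at h1
    omega

/-- A fragment that moves gets its new labels later than the fragment to which it attaches itself. -/
theorem slot_lt_of_proposes {a b : V} {p q : ℕ} (h : (σ 3 a).Proposes p) (hl : N.Link a p b q)
    (ha : (σ 6 a).Moves) : (σ 6 b).slot D K < (σ 6 a).slot D K := by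
  refine hR.slot_lt_of_rank_lt hne hK ha fun hb => ?_
  have hca := hR.color_six hne a
  have hcb := hR.color_six hne b
  have hKa := hK a
  have hKb := hK b
  have hb0 := hb.1
  have hup := hR.down_mem_iff hne h hl rfl
  rcases Nat.lt_or_gt_of_ne (hR.hue_ne h hl) with hlt | hlt
  -- Upward proposal: the rank of `a` exceeds `K`, hence every downward rank, and it exceeds the
  -- rank of an upward target because that has the larger color.
  · have h1 : (0, 1) ∉ (σ 6 a).all := fun h => absurd (hup.1 h) (by omega)
    simp only [VState.rank, h1, if_false]
    split_ifs <;> omega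
  -- Downward proposal: `b` holds `(0, 0)`, so it moves only if its own proposal goes down too, and
  -- then ranks are colors.
  · have h1 := hup.2 hlt
    obtain ⟨z, hz⟩ := hR.exists_pick_of_moves hne hb
    have h2 := (hR.child_mem_iff hne hz).2 ⟨b, q, a, p, rfl, hl.symm, h, hlt⟩
    have h3 : (0, 1) ∈ (σ 6 b).all := hb.2.resolve_right (fun h => h h2)
    simp only [VState.rank, h1, h3, if_true]
    omega

/-- The new parent of a vertex of a fragment that moves. -/
theorem exists_npar {v : V} (h : (σ 6 v).Moves) :
    ∃ p u q, (σ 6 v).npar = some p ∧ N.Link v p u q ∧ (σ 6 u).slot D K < (σ 6 v).slot D K ∧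
      ((σ 3 v).Proposes p ∨ (κ u).root = (κ v).root) := by
  classical
  rw [hR.npar_six hne]
  by_cases hp : ∃ p, (σ 3 v).Proposes p
  · obtain ⟨p, hp⟩ := hp
    obtain ⟨b, q, z, hl, -⟩ := hR.exists_of_proposes hp
    exact ⟨p, b, q, VState.reroot_eq_of_proposes hp, hl, hR.slot_lt_of_proposes hne hK hp hl h,
      Or.inl hp⟩
  obtain ⟨z, hz⟩ := hR.exists_pick_of_moves hne h
  obtain ⟨hz1, hz0⟩ := VState.pick_eq_some hz
  have hv := hR.depth_lt_of_moves hne h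
  -- inside the fragment only the position relative to the path matters
  have key : ∀ u, (κ u).root = (κ v).root →
      (if (σ 6 u).onPath then D - (κ u).depth else D + (κ u).depth) <
        (if (σ 6 v).onPath then D - (κ v).depth else D + (κ v).depth) →
      (σ 6 u).slot D K < (σ 6 v).slot D K := by
    intro u hu hlt
    obtain ⟨h1, h2⟩ := hR.moves_of_root hne hu h
    unfold VState.slot
    rw [if_pos h1, if_pos h, h2]
    simp only [hR.core_six hne]
    omega
  -- Above the proposer on the path, the pointer is reversed towards the child that delivered the
  -- item; this child is deeper and on the path, hence earlier.
  by_cases hg : ∃ p z, (σ 3 v).pick = some z ∧ z ∈ (σ 3 v).got p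
  · have e : (σ 3 v).reroot = some hg.choose := by
      unfold VState.reroot; rw [dif_neg hp, dif_pos hg]
    obtain ⟨z', hz', hgot⟩ := hg.choose_spec
    rw [hz] at hz'
    obtain rfl := Option.some.inj hz'
    obtain ⟨c, q, hl, hc, hcd, hcs⟩ := hR.shared.got_source v _ z hv hgot
    obtain ⟨e1, e2⟩ := hR.forest.of_par_some hc hl.symm
    refine ⟨_, c, q, e, hl, key c e1 ?_, Or.inr e1⟩
    have o1 : (σ 6 c).onPath :=
      (hR.onPath_six hne c).2 ⟨z, by rw [hR.pick_eq e1, hz], hcs⟩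
    rw [if_pos o1]
    split_ifs <;> omega
  -- Off the path the old parent is kept; it is less deep or on the path, hence earlier.
  · have e : (σ 3 v).reroot = (κ v).par := by
      unfold VState.reroot; rw [dif_neg hp, dif_neg hg, hR.core_three]
    have o1 : ¬ (σ 6 v).onPath := by
      rw [hR.onPath_six hne]
      rintro ⟨z', hz', hs⟩
      rcases hR.shared.sub_source v z' hv hs with h' | ⟨p, h'⟩
      · rcases hR.mem_sub_one.1 h' with ⟨x, hx, hx'⟩ | ⟨-, rfl⟩
        · exact hp ⟨x.1, z', x, hz', by rw [hx', hR.core_three, hR.forest.id_eq], hx, rfl⟩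
        · rw [hz] at hz'
          obtain rfl := Option.some.inj hz'
          exact hz0 hz1
      · exact hg ⟨p, z', hz', h'⟩
    cases hpar : (κ v).par with
    | none =>
      -- At the root `sub` equals `all` and contains the pick, so the root lies on the path.
      exfalso
      refine o1 ((hR.onPath_six hne v).2 ⟨z, hz, ?_⟩)
      rw [← hR.shared.all_root v hv hpar]
      exact hz1
    | some q =>
      obtain ⟨u, q', hl⟩ := hR.forest.exists_parent hpar
      obtain ⟨e1, e2⟩ := hR.forest.of_par_some hpar hl
      refine ⟨q, u, q', by rw [e, hpar], hl, key u e1.symm ?_, Or.inr e1.symm⟩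
      rw [if_neg o1]
      split_ifs <;> omega

theorem ptime_lt_time (v : V) : (σ 7 v).ptime < (σ 7 v).time := by
  have ht : (σ 7 v).time = (σ 6 v).slot D K := by rw [hR.arranged hne]; rfl
  rw [ht]
  by_cases h : (σ 6 v).Moves
  · obtain ⟨p, u, q, h1, h2, h3, -⟩ := hR.exists_npar hne hK h
    rwa [hR.ptime_of_moves hne h h1 h2]
  · have : (σ 7 v).ptime = 0 := by
      rw [hR.arranged hne]; simp [VState.arrange, h]
    rw [this]
    exact hR.slot_pos hne v

theorem relabelled (v : V) : σ 8 v = (σ 7 v).relabel (inboxOf N (fun v u =>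
    if True ∧ (σ 7 u).time = (σ 7 v).ptime then some (σ 8 u) else none) v) := by
  have h1 : (σ 7 v).time = (σ 6 v).slot D K := by rw [hR.arranged hne]; rfl
  refine active_step (act := fun _ => True) (hR.step 7 (by norm_num)) (hR.done_seven hne)
    (fun v _ => hR.ptime_lt_time hne hK v) v trivial ?_
  exact ((hR.ptime_lt_time hne hK v).trans_eq h1).trans (hR.slot_lt_stageBound hne hK v)

theorem done_eight (v : V) : (σ 8 v).done = false := by
  rw [hR.relabelled hne hK]; exact hR.done_seven hne v

theorem id_eight (v : V) : (σ 8 v).id = (κ v).id ∧ (σ 8 v).deg = (κ v).deg := by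
  rw [hR.relabelled hne hK, hR.arranged hne, ← hR.core_six hne v]
  exact ⟨rfl, rfl⟩

/-- Such a vertex listens in the silent round `0`, receives nothing and keeps its label. -/
theorem eight_of_not_moves {v : V} (h : ¬ (σ 6 v).Moves) : (σ 8 v).par = (κ v).par ∧
    (σ 8 v).root = (κ v).root ∧ (σ 8 v).depth = (κ v).depth := by
  have hp : (σ 7 v).ptime = 0 := by
    rw [hR.arranged hne]; simp [VState.arrange, h]
  have hin : ∀ p, inboxOf N (fun v u =>
      if True ∧ (σ 7 u).time = (σ 7 v).ptime then some (σ 8 u) else none) v p = none := by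
    intro p
    by_contra hc
    obtain ⟨m, hm⟩ := Option.ne_none_iff_exists'.1 hc
    obtain ⟨u, -, hu⟩ := inboxOf_eq_some.1 hm
    have := hR.ptime_lt_time hne hK u
    rw [if_neg (by omega)] at hu
    simp at hu
  have hb : ∀ o : Option ℕ, (o.bind (inboxOf N (fun v u =>
      if True ∧ (σ 7 u).time = (σ 7 v).ptime then some (σ 8 u) else none) v)) = none := by
    rintro (_ | p)
    · rfl
    · exact hin p
  rw [hR.relabelled hne hK]
  simp only [VState.relabel, hb, Option.map_none, Option.getD_none]
  rw [hR.arranged hne]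
  simp only [VState.arrange, h, if_false, hR.core_six hne, and_self]

theorem eight_of_moves {v u : V} {p q : ℕ} (h : (σ 6 v).Moves) (hp : (σ 6 v).npar = some p)
    (hl : N.Link v p u q) : (σ 8 v).par = some p ∧ (σ 8 v).root = (σ 8 u).root ∧
      (σ 8 v).depth = (σ 8 u).depth + 1 := by
  have ht : (σ 7 u).time = (σ 6 u).slot D K := by rw [hR.arranged hne]; rfl
  have h7 : (σ 7 v).par = some p := by
    rw [hR.arranged hne]; simp [VState.arrange, h, hp]
  have : inboxOf N (fun v u =>
      if True ∧ (σ 7 u).time = (σ 7 v).ptime then some (σ 8 u) else none) v p = some (σ 8 u, q) :=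
    inboxOf_eq_some.2 ⟨u, hl, if_pos ⟨trivial, by rw [ht, hR.ptime_of_moves hne h hp hl]⟩⟩
  rw [hR.relabelled hne hK v]
  simp only [VState.relabel, h7, Option.bind_some, this]
  exact ⟨trivial, rfl, rfl⟩

/-- The new pointers and labels form a forest again. -/
theorem forest_eight : IsForest N fun v => (σ 8 v).toCore := by
  refine ⟨fun v => ?_, fun v => ?_, fun v => ?_⟩
  · rw [(hR.id_eight hne hK v).1, hR.forest.id_eq]
  · rw [(hR.id_eight hne hK v).2, hR.forest.deg_eq]
  · by_cases h : (σ 6 v).Moves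
    · obtain ⟨p, u, q, h1, h2, -⟩ := hR.exists_npar hne hK h
      obtain ⟨e1, e2, e3⟩ := hR.eight_of_moves hne hK h h1 h2
      exact Or.inr ⟨p, u, q, e1, h2, e2, e3⟩
    · obtain ⟨e1, e2, e3⟩ := hR.eight_of_not_moves hne hK h
      rcases hR.forest.label v with ⟨h1, h2, h3⟩ | ⟨q, u, q', h1, h2, h3, h4⟩
      · exact Or.inl ⟨e1.trans h1, e3.trans h2, e2.trans h3⟩
      · have hu : ¬ (σ 6 u).Moves := fun hu => h (hR.moves_of_root hne h3 hu).1
        obtain ⟨f1, f2, f3⟩ := hR.eight_of_not_moves hne hK hu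
        exact Or.inr ⟨q, u, q', e1.trans h1, h2, by rw [e2, f2, h3], by rw [e3, f3, h4]⟩

/-- New pointers strictly decrease the slot, so following them from `v` stays in the fragment until
the proposer `a` hands over to `b`. -/
theorem root_eight_of_moves {a b : V} {p q : ℕ} (h : (σ 3 a).Proposes p) (hl : N.Link a p b q)
    (ha : (σ 6 a).Moves) {v : V} (hv : (κ v).root = (κ a).root) :
    (σ 8 v).root = (σ 8 b).root := by
  induction hn : (σ 6 v).slot D K using Nat.strong_induction_on generalizing v with
  | _ n ih =>
    have hm := (hR.moves_of_root hne hv ha).1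
    obtain ⟨p', u, q', h1, h2, h3, h4⟩ := hR.exists_npar hne hK hm
    rw [(hR.eight_of_moves hne hK hm h1 h2).2.1]
    rcases h4 with h4 | h4
    · obtain ⟨rfl, rfl⟩ := hR.proposes_unique h4 h hv
      obtain ⟨rfl, rfl⟩ := hl.unique h2
      rfl
    · exact ih _ (by omega) (h4.trans hv) rfl

theorem root_eight_eq {u v : V} (h : (κ u).root = (κ v).root) :
    (σ 8 u).root = (σ 8 v).root := by
  by_cases hv : (σ 6 v).Moves
  · obtain ⟨z, hz⟩ := hR.exists_pick_of_moves hne hv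
    obtain ⟨a, p, ha, hp⟩ := hR.exists_proposes hz
    obtain ⟨b, q, -, hl, -⟩ := hR.exists_of_proposes hp
    have hm := (hR.moves_of_root hne ha hv).1
    rw [hR.root_eight_of_moves hne hK hp hl hm (h.trans ha.symm),
      hR.root_eight_of_moves hne hK hp hl hm ha.symm]
  · have hu : ¬ (σ 6 u).Moves := fun hu => hv (hR.moves_of_root hne h.symm hu).1
    rw [(hR.eight_of_not_moves hne hK hv).2.1, (hR.eight_of_not_moves hne hK hu).2.1, h]

/-- Every fragment is deep or merges with another one. -/
theorem deep_or_merges (v : V) : (∃ u, (κ u).root = (κ v).root ∧ D ≤ (κ u).depth) ∨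
    ∃ u, (κ u).root ≠ (κ v).root ∧ (σ 8 u).root = (σ 8 v).root := by
  cases hz : (σ 3 v).pick with
  | none => exact Or.inl (hR.exists_deep (VState.pick_eq_none hz (hne v)))
  | some z =>
    right
    by_cases hv : (σ 6 v).Moves
    · obtain ⟨a, p, ha, hp⟩ := hR.exists_proposes hz
      obtain ⟨b, q, -, hl, -, -, -, hb⟩ := hR.exists_of_proposes hp
      exact ⟨b, by rwa [← ha],
        (hR.root_eight_of_moves hne hK hp hl (hR.moves_of_root hne ha hv).1 ha.symm).symm⟩
    -- A proposing fragment that stays has received a proposal from a larger color; that proposal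
    -- goes down, so its sender moves and attaches itself here.
    · have h0 : (σ 6 v).color ≠ 0 := by
        rw [hR.color_six hne, hR.hue_of_pick hz]; omega
      have h1 : (0, 0) ∈ (σ 6 v).all := by
        by_contra hc
        exact hv ⟨h0, Or.inr hc⟩
      obtain ⟨b, p, a, q, hb, hl, hq, hlt⟩ := (hR.child_mem_iff hne hz).1 h1
      obtain ⟨b', p', -, hl', -, -, -, hb'⟩ := hR.exists_of_proposes hq
      obtain ⟨rfl, rfl⟩ := hl'.unique hl.symm
      have hm : (σ 6 a).Moves := by
        refine ⟨?_, Or.inl ((hR.down_mem_iff hne hq hl.symm rfl).2 hlt)⟩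
        rw [hR.color_six hne]
        omega
      refine ⟨a, by rw [← hb]; exact hb'.symm, ?_⟩
      rw [hR.root_eight_of_moves hne hK hq hl.symm hm rfl, hR.root_eight_eq hne hK hb]

-- A deep fragment has a vertex at each of the `D` depths below `D`; any other new fragment contains
-- two disjoint old ones. Old fragments are never split.
open scoped Classical in
theorem card_fragment_eight [Fintype V] {m : ℕ} (hm : 2 * m ≤ D)
    (hcard : ∀ v, m ≤ (Finset.univ.filter fun u => (κ u).root = (κ v).root).card) (v : V) :
    2 * m ≤ (Finset.univ.filter fun u => (σ 8 u).root = (σ 8 v).root).card := by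
  have hsub : ∀ w, (σ 8 w).root = (σ 8 v).root →
      (Finset.univ.filter fun u => (κ u).root = (κ w).root) ⊆
      Finset.univ.filter fun u => (σ 8 u).root = (σ 8 v).root := by
    intro w hw u hu
    simp only [Finset.mem_filter, Finset.mem_univ, true_and] at hu ⊢
    rw [hR.root_eight_eq hne hK hu, hw]
  rcases hR.deep_or_merges hne hK v with ⟨w, hw, hd⟩ | ⟨w, hw, hw'⟩
  · refine hm.trans (le_trans ?_ (Finset.card_le_card (hsub v rfl)))
    choose f hf hf' using fun j : Fin D => hR.forest.exists_ancestor w j (by omega)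
    have hinj : Function.Injective f := fun i j hij => by
      have := hf' i
      rw [hij, hf' j] at this
      exact Fin.ext this.symm
    have := Finset.card_le_card_of_injOn (s := (Finset.univ : Finset (Fin D)))
      (t := Finset.univ.filter fun u => (κ u).root = (κ v).root) f
      (fun j _ => by simp [hf, hw]) hinj.injOn
    simpa using this
  · have hdisj : Disjoint (Finset.univ.filter fun u => (κ u).root = (κ v).root)
        (Finset.univ.filter fun u => (κ u).root = (κ w).root) := by
      rw [Finset.disjoint_left]
      intro u hu hu'
      simp only [Finset.mem_filter, Finset.mem_univ, true_and] at hu hu'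
      exact hw (hu'.symm.trans hu)
    have h1 := Finset.card_le_card (Finset.union_subset (hsub v rfl) (hsub w hw'))
    rw [Finset.card_union_of_disjoint hdisj] at h1
    have h2 := hcard v
    have h3 := hcard w
    omega

end PhaseRun

/-! ### The final forest is a distributed layered tree -/

section ParentGraph

variable {V : Type*} {parent : V → Option V} {root : V} {d : V → ℕ}

theorem parentGraph_adj {a b : V} :
    (parentGraph parent).Adj a b ↔ a ≠ b ∧ (parent a = some b ∨ parent b = some a) :=
  SimpleGraph.fromRel_adj _ _ _

variable (h0 : parent root = none) (hd0 : d root = 0)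
  (hp : ∀ v, v ≠ root → ∃ u, parent v = some u ∧ d v = d u + 1)
include h0 hd0 hp

theorem exists_walk_parentGraph (v : V) :
    ∃ w : (parentGraph parent).Walk v root, w.length = d v := by
  induction hn : d v generalizing v with
  | zero =>
    by_cases hv : v = root
    · subst hv; exact ⟨.nil, rfl⟩
    · obtain ⟨u, -, h2⟩ := hp v hv
      omega
  | succ n ih =>
    have hv : v ≠ root := by rintro rfl; omega
    obtain ⟨u, h1, h2⟩ := hp v hv
    obtain ⟨w, hw⟩ := ih u (by omega)
    have hadj : (parentGraph parent).Adj v u :=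
      parentGraph_adj.2 ⟨fun h => by rw [← h] at h2; omega, Or.inl h1⟩
    exact ⟨.cons hadj w, by rw [SimpleGraph.Walk.length_cons, hw]⟩

/-- Every edge joins a vertex to its parent and changes the depth by one, so no walk is shorter than
the pointers suggest. -/
theorem depth_le_add_length {a b : V} (w : (parentGraph parent).Walk a b) :
    d b ≤ d a + w.length := by
  have key : ∀ x y, parent x = some y → d x = d y + 1 := by
    intro x y hxy
    have hx : x ≠ root := by rintro rfl; rw [h0] at hxy; simp at hxy
    obtain ⟨u, h1, h2⟩ := hp x hx
    rw [hxy] at h1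
    rw [h2, Option.some.inj h1]
  induction w with
  | nil => simp
  | @cons a c b hac w ih =>
    rw [SimpleGraph.Walk.length_cons]
    rcases (parentGraph_adj.1 hac).2 with h | h
    · have := key _ _ h; omega
    · have := key _ _ h; omega

theorem dist_parentGraph (v : V) : (parentGraph parent).dist root v = d v := by
  obtain ⟨w, hw⟩ := exists_walk_parentGraph h0 hd0 hp v
  refine le_antisymm ?_ ?_
  · rw [← hw, SimpleGraph.dist_comm]
    exact SimpleGraph.dist_le w
  · obtain ⟨w', hw'⟩ := w.reverse.reachable.exists_walk_length_eq_dist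
    have := depth_le_add_length h0 hd0 hp w'
    omega

/-- The graph is connected, and each edge is the parent edge of some non-root vertex, so there are
at most `n - 1` edges. -/
theorem isTree_parentGraph [Finite V] : (parentGraph parent).IsTree := by
  classical
  have hc : (parentGraph parent).Connected := by
    have : Nonempty V := ⟨root⟩
    refine ⟨fun a b => ?_⟩
    obtain ⟨w, -⟩ := exists_walk_parentGraph h0 hd0 hp a
    obtain ⟨w', -⟩ := exists_walk_parentGraph h0 hd0 hp b
    exact (w.append w'.reverse).reachable
  rw [SimpleGraph.isTree_iff_connected_and_card]
  refine ⟨hc, le_antisymm ?_ hc.card_vert_le_card_edgeSet_add_one⟩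
  have hsub : (parentGraph parent).edgeSet ⊆
      (fun v => s(v, (parent v).getD v)) '' ({root}ᶜ : Set V) := by
    intro e
    induction e with
    | _ a b =>
      intro he
      have hne : ∀ x y, parent x = some y → x ≠ root := by
        rintro x y hxy rfl; rw [h0] at hxy; simp at hxy
      rcases (parentGraph_adj.1 he).2 with h | h
      · exact ⟨a, hne _ _ h, by simp [h]⟩
      · exact ⟨b, hne _ _ h, by simp [h, Sym2.eq_swap]⟩
  have h1 := Set.ncard_le_ncard hsub (Set.toFinite _)
  have h2 := Set.ncard_image_le (f := fun v => s(v, (parent v).getD v))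
    (Set.toFinite ({root}ᶜ : Set V))
  have h3 := Set.ncard_add_ncard_compl ({root} : Set V)
  rw [Set.ncard_singleton] at h3
  rw [Nat.card_coe_set_eq]
  omega

end ParentGraph

theorem IsForest.isDLT {V : Type*} [Finite V] {N : Network V} {κ : V → Core} (hF : IsForest N κ)
    {σ : V → VState} (hσ : ∀ v, (σ v).toCore = κ v) {r : V} (hr : (κ r).par = none)
    (hroot : ∀ v, (κ v).root = (κ r).root) :
    IsDLT N (fun v => dltOutput (σ v)) r ∧ ∀ v, (dltOutput (σ v)).label = toLex (N.ident r,
      (parentGraph (parentOf N fun w => dltOutput (σ w))).dist r v) := by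
  set parent := parentOf N fun w => dltOutput (σ w) with hparent
  have hnone : ∀ v, (κ v).par = none → parent v = none := by
    intro v hv
    simp [hparent, parentOf, dltOutput, hσ, hv]
  have hsome : ∀ v q u q', (κ v).par = some q → N.Link v q u q' → parent v = some u := by
    intro v q u q' hv hl
    simp [hparent, parentOf, dltOutput, hσ, hv, hl.neighbor?]
  have hinv : ∀ v u, parent v = some u → ∃ q q', (κ v).par = some q ∧ N.Link v q u q' := by
    intro v u h
    rcases hF.label v with ⟨h', -⟩ | ⟨q, w, q', h1, h2, -⟩
    · rw [hnone v h'] at h; simp at h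
    · rw [hsome v q w q' h1 h2] at h
      obtain rfl := Option.some.inj h
      exact ⟨q, q', h1, h2⟩
  have h0 : parent r = none := hnone r hr
  have hd0 : (κ r).depth = 0 := (hF.of_par_none hr).1
  have hp : ∀ v, v ≠ r → ∃ u, parent v = some u ∧ (κ v).depth = (κ u).depth + 1 := by
    intro v hv
    rcases hF.label v with ⟨h', -⟩ | ⟨q, w, q', h1, h2, -, h4⟩
    · exact absurd (hF.root_unique h' hr (hroot v)) hv
    · exact ⟨w, hsome v q w q' h1 h2, h4⟩
  have hdist := dist_parentGraph (d := fun v => (κ v).depth) h0 hd0 hp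
  refine ⟨⟨⟨?_, isTree_parentGraph (d := fun v => (κ v).depth) h0 hd0 hp, h0, ?_⟩, ?_, ?_, ?_⟩,
    fun v => ?_⟩
  · intro a b hab
    rcases (parentGraph_adj.1 hab).2 with h | h
    · obtain ⟨q, q', -, hl⟩ := hinv _ _ h
      exact hl.adj
    · obtain ⟨q, q', -, hl⟩ := hinv _ _ h
      exact hl.adj.symm
  · intro v hv
    obtain ⟨u, h1, h2⟩ := hp v hv
    exact ⟨u, h1, by rw [hdist, hdist]; exact h2⟩
  · simp [dltOutput, hσ, hr]
  · intro v u h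
    obtain ⟨q, q', h1, h2⟩ := hinv _ _ h
    obtain ⟨e1, e2⟩ := hF.of_par_some h1 h2
    simp only [dltOutput, hσ]
    rw [Prod.Lex.toLex_lt_toLex]
    right
    exact ⟨e1.symm, by simp only; omega⟩
  · intro v u h
    obtain ⟨q, q', h1, h2⟩ := hinv _ _ h
    obtain ⟨e1, e2⟩ := hF.of_par_some h1 h2
    simp [dltOutput, hσ, h1, e1, e2]
  · rw [hdist]
    simp only [dltOutput, hσ]
    rw [hroot v, (hF.of_par_none hr).2]

/-! ### The iterated logarithm -/

/-- From `m + 1 ≤ 2 ^ m`, a logarithm lowers the bound `m + 1` to `m`. So the set defining `logStar`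
is nonempty, and its `sInf` is not the default value. -/
theorem exists_iterate_logb_le_one (m : ℕ) (x : ℝ) (hx : x ≤ m) :
    ∃ k : ℕ, (Real.logb 2)^[k] x ≤ 1 := by
  induction m generalizing x with
  | zero => exact ⟨0, (hx.trans_eq Nat.cast_zero).trans zero_le_one⟩
  | succ m ih =>
    by_cases h1 : x ≤ 1
    · exact ⟨0, h1⟩
    · rw [not_le] at h1
      have h2 : Real.logb 2 x ≤ m := by
        rw [Real.logb_le_iff_le_rpow (by norm_num) (by linarith), Real.rpow_natCast]
        refine hx.trans ?_
        exact_mod_cast (Nat.lt_two_pow_self : m < 2 ^ m)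
      obtain ⟨k, hk⟩ := ih _ h2
      exact ⟨k + 1, by rwa [Function.iterate_succ_apply]⟩

theorem one_le_logStar {n : ℕ} (hn : 2 ≤ n) : 1 ≤ logStar n := by
  have h := Nat.sInf_mem (s := {k : ℕ | (Real.logb 2)^[k] (n : ℝ) ≤ 1})
    (exists_iterate_logb_le_one n n le_rfl)
  by_contra hc
  have h0 : sInf {k : ℕ | (Real.logb 2)^[k] (n : ℝ) ≤ 1} = 0 := by
    unfold logStar at hc; omega
  rw [h0] at h
  have : (n : ℝ) ≤ 1 := h
  have : n ≤ 1 := by exact_mod_cast this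
  omega

/-! ### All phases -/

section Phases

variable {V : Type*} (N : Network V) (nhat : ℕ)

/-- The algorithm that constructs a distributed layered tree. -/
noncomputable def dltAlgorithm : Algorithm (DLTOutput (ℕ ×ₗ ℕ)) :=
  stagedAlgorithm dltPlan dltInit dltOutput

/-- The states of the vertices at the beginning of the `i`-th stage. -/
noncomputable def dltStates (i : ℕ) : V → VState :=
  run dltPlan dltInit dltOutput N nhat (startTime (stageLen dltPlan nhat) i)

open scoped Classical in
/-- What holds at the beginning of phase `p`. -/
structure PhaseInv [Fintype V] (p : ℕ) : Prop where
  forest : IsForest N fun v => (dltStates N nhat (8 * p) v).toCore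
  fresh : ∀ v, (dltStates N nhat (8 * p) v).done = false
  card : ∀ v, 2 ^ p ≤ (Finset.univ.filter fun u =>
    (dltStates N nhat (8 * p) u).root = (dltStates N nhat (8 * p) v).root).card

theorem dltPlan_eq (p j : ℕ) (hj : j < 8) :
    dltPlan nhat (8 * p + j) = phaseStage (2 ^ (p + 1)) (maxColor nhat) j := by
  unfold dltPlan
  rw [show (8 * p + j) / 8 = p by omega, show (8 * p + j) % 8 = j by omega]

theorem stageLen_dltPlan_pos (i : ℕ) : 0 < stageLen dltPlan nhat i :=
  phaseStage_len_pos (by positivity) _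

theorem dltPlan_steady (i : ℕ) : (dltPlan nhat i).Steady := phaseStage_steady _ _ _

/-- The eight stages of phase `p` take at most `32 * (2 * maxColor nhat + 1) * 2 ^ p` rounds; this
is a geometric series. -/
theorem startTime_dltPlan_le (p : ℕ) :
    startTime (stageLen dltPlan nhat) (8 * p) ≤ 32 * (2 * maxColor nhat + 1) * 2 ^ p := by
  induction p with
  | zero => simp [startTime]
  | succ p ih =>
    have h : ∀ j < 8, stageLen dltPlan nhat (8 * p + j) ≤
        4 * (2 * maxColor nhat + 1) * 2 ^ p := by
      intro j hj
      unfold stageLen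
      rw [dltPlan_eq nhat p j hj]
      refine (phaseStage_len_le (by positivity) j).trans (le_of_eq ?_)
      unfold stageBound
      ring
    have h' : startTime (stageLen dltPlan nhat) (8 * (p + 1)) =
        startTime (stageLen dltPlan nhat) (8 * p) +
          ∑ j ∈ Finset.range 8, stageLen dltPlan nhat (8 * p + j) := by
      unfold startTime
      rw [Nat.mul_succ, Finset.sum_range_add]
    have h'' := Finset.sum_le_card_nsmul (Finset.range 8)
      (fun j => stageLen dltPlan nhat (8 * p + j)) _ (fun j hj => h j (Finset.mem_range.1 hj))
    rw [Finset.card_range, smul_eq_mul] at h''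
    rw [h', pow_succ]
    linarith

theorem startTime_mono {i j : ℕ} (h : i ≤ j) :
    startTime (stageLen dltPlan nhat) i ≤ startTime (stageLen dltPlan nhat) j :=
  Finset.sum_le_sum_of_subset (Finset.range_mono h)

variable {N nhat}

/-- A vertex that is done has both its rounds equal to the stage length, which the clock never
shows. -/
theorem not_isAwake_of_done {r : ℕ} {v : V}
    (h : (run dltPlan dltInit dltOutput N nhat r v).done = true) :
    ¬ IsAwake dltAlgorithm N nhat v r := by
  have h1 := states_staged_fst dltPlan dltInit dltOutput N nhat r v
  have hc := clock_snd_lt (stageLen_dltPlan_pos nhat) r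
  unfold IsAwake dltAlgorithm
  unfold run at h
  generalize states (stagedAlgorithm dltPlan dltInit dltOutput) N nhat r v = x at h h1 ⊢
  obtain ⟨a, s⟩ := x
  obtain rfl : a = nhat := h1
  have key : ∀ i, (dltPlan a i).listen s = stageLen dltPlan a i ∧
      (dltPlan a i).speak s = stageLen dltPlan a i := by
    intro i
    have h' : s.done = true := h
    unfold stageLen dltPlan phaseStage
    split <;>
      simp [exchangeStage, gatherStage, spreadStage, relabelStage, activeStage, h']
  simp only [stagedAlgorithm, Bool.or_eq_true, decide_eq_true_eq, (key _).1, (key _).2, or_self]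
  omega

theorem run_eq_of_done {r : ℕ} {v : V}
    (h : (run dltPlan dltInit dltOutput N nhat r v).done = true) (t : ℕ) :
    run dltPlan dltInit dltOutput N nhat (r + t) v =
      run dltPlan dltInit dltOutput N nhat r v := by
  induction t with
  | zero => rfl
  | succ t ih =>
    have := not_isAwake_of_done (ih.symm ▸ h)
    rw [← ih, ← add_assoc]
    exact congrArg Prod.snd (if_neg this)

variable (hid : ∀ v, N.ident v ∈ Finset.Icc 1 nhat)
include hid

theorem PhaseInv.phaseRun [Fintype V] {p : ℕ} (h : PhaseInv N nhat p) :
    PhaseRun N (2 ^ (p + 1)) (maxColor nhat) (fun v => (dltStates N nhat (8 * p) v).toCore)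
      (fun j => dltStates N nhat (8 * p + j)) where
  depth_pos := by positivity
  ident_pos v := (Finset.mem_Icc.1 (hid v)).1
  forest := h.forest
  core _ := rfl
  fresh := h.fresh
  step j hj := by
    rw [← dltPlan_eq nhat p j hj]
    exact stageStep_run (stageLen_dltPlan_pos nhat) (dltPlan_steady nhat) (8 * p + j)

omit hid in
theorem phaseInv_zero [Fintype V] : PhaseInv N nhat 0 where
  forest := ⟨fun _ => rfl, fun _ => rfl, fun _ => Or.inl ⟨rfl, rfl, rfl⟩⟩
  fresh _ := rfl
  card v := by
    rw [pow_zero, Nat.one_le_iff_ne_zero, Finset.card_ne_zero]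
    exact ⟨v, by simp⟩

theorem PhaseInv.succ [Fintype V] {p : ℕ} (h : PhaseInv N nhat p)
    (hne : ∀ v, (dltStates N nhat (8 * p + 3) v).all ≠ ∅) : PhaseInv N nhat (p + 1) := by
  have hR := h.phaseRun hid
  have hK := hR.hue_le (fun v => (Finset.mem_Icc.1 (hid v)).2)
  refine ⟨hR.forest_eight hne hK, hR.done_eight hne hK, fun v => ?_⟩
  have := hR.card_fragment_eight hne hK (m := 2 ^ p) (by rw [pow_succ]; omega) h.card v
  rw [pow_succ, mul_comm]
  exact this

/-- Otherwise the fragments would double in every phase and outgrow `V`. -/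
theorem exists_last_phase [Fintype V] [Nonempty V] :
    ∃ p, PhaseInv N nhat p ∧ ∃ v, (dltStates N nhat (8 * p + 3) v).all = ∅ := by
  by_contra hc
  push Not at hc
  have : ∀ p, PhaseInv N nhat p := by
    intro p
    induction p with
    | zero => exact phaseInv_zero
    | succ p ih => exact ih.succ hid (fun v => (hc p ih v).ne_empty)
  have h1 := (this (Fintype.card V)).card (Classical.arbitrary V)
  have h2 := h1.trans (Finset.card_le_univ _)
  exact absurd (Nat.lt_two_pow_self (n := Fintype.card V)) (by omega)

end Phases

/-! ### Numerical bounds and the main theorem -/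

theorem startTime_bound {n nhat p : ℕ} (hn : 2 ^ p ≤ n) (hnh : n ≤ nhat) :
    ((startTime (stageLen dltPlan nhat) (8 * p + 4) : ℕ) : ℝ) ≤
      576 * (nhat * Real.logb 2 nhat * logStar nhat + 1) := by
  have h1 : startTime (stageLen dltPlan nhat) (8 * p + 4) ≤ 64 * (4 * Nat.log 2 nhat + 5) * nhat := by
    refine (startTime_mono nhat (show 8 * p + 4 ≤ 8 * (p + 1) by omega)).trans
      ((startTime_dltPlan_le nhat (p + 1)).trans ?_)
    unfold maxColor
    calc 32 * (2 * (2 * (Nat.log 2 nhat + 1)) + 1) * 2 ^ (p + 1)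
        = 64 * (4 * Nat.log 2 nhat + 5) * 2 ^ p := by ring
      _ ≤ _ := Nat.mul_le_mul_left _ (hn.trans hnh)
  have h2 : ((startTime (stageLen dltPlan nhat) (8 * p + 4) : ℕ) : ℝ) ≤
      64 * (4 * (Nat.log 2 nhat : ℕ) + 5) * nhat := by exact_mod_cast h1
  have hpos : 1 ≤ nhat := (Nat.one_le_two_pow.trans hn).trans hnh
  rcases Nat.lt_or_ge nhat 2 with h | h
  · obtain rfl : nhat = 1 := by omega
    refine h2.trans ?_
    norm_num
  · have h3 : ((Nat.log 2 nhat : ℕ) : ℝ) ≤ Real.logb 2 nhat := by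
      have := Real.natLog_le_logb nhat 2
      exact_mod_cast this
    have h4 : (1 : ℝ) ≤ Real.logb 2 nhat := by
      rw [Real.le_logb_iff_rpow_le (by norm_num) (by positivity), Real.rpow_one]
      exact_mod_cast h
    have h5 : (1 : ℝ) ≤ logStar nhat := by exact_mod_cast one_le_logStar h
    have h6 : (0 : ℝ) ≤ nhat := by positivity
    have h7 : (nhat : ℝ) * Real.logb 2 nhat ≤ nhat * Real.logb 2 nhat * logStar nhat :=
      le_mul_of_one_le_right (by positivity) h5
    -- With a logarithm of at least `1`, the factor `4 * log + 5` is at most `9 * log`, and `64 * 9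
    -- = 576`.
    have h8 : (64 * (4 * (Nat.log 2 nhat : ℕ) + 5) * nhat : ℝ) ≤
        64 * (9 * Real.logb 2 nhat) * nhat := by
      gcongr
      linarith
    linarith

theorem awake_bound {n p : ℕ} (hn : 2 ^ p ≤ n) :
    ((2 * (8 * p + 4) : ℕ) : ℝ) ≤ 576 * (Real.logb 2 n * logStar n + 1) := by
  have h1 : p ≤ Nat.log 2 n :=
    Nat.le_log_of_pow_le (by norm_num) hn
  have h2 : (p : ℝ) ≤ Real.logb 2 n := by
    have h3 := Real.natLog_le_logb n 2
    have h4 : (p : ℝ) ≤ (Nat.log 2 n : ℕ) := by exact_mod_cast h1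
    exact h4.trans (by exact_mod_cast h3)
  have h0 : 1 ≤ n := Nat.one_le_two_pow.trans hn
  push_cast
  rcases Nat.lt_or_ge n 2 with h | h
  · obtain rfl : n = 1 := by omega
    simp only [Nat.cast_one, Real.logb_one] at h2 ⊢
    linarith
  · have h5 : (1 : ℝ) ≤ logStar n := by exact_mod_cast one_le_logStar h
    have h6 : (0 : ℝ) ≤ p := by positivity
    have h7 := le_mul_of_one_le_right (h6.trans h2) h5
    linarith

/-- In the last phase one empty item set shows that a single fragment spans the network. All
vertices then become done in the fourth stage, hence `8 * p + 4` stages, and keep the tree with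
which the phase began. -/
theorem dltAlgorithm_correct {V : Type*} [Fintype V] (N : Network V) (nhat : ℕ)
    (hc : N.graph.Connected) (hid : ∀ v, N.ident v ∈ Finset.Icc 1 nhat) :
    ∃ p, 2 ^ p ≤ Fintype.card V ∧
      let R := startTime (stageLen dltPlan nhat) (8 * p + 4)
      TerminatesWithin dltAlgorithm N nhat R ∧
      (∀ v, awakeTime dltAlgorithm N nhat R v ≤ 2 * (8 * p + 4)) ∧
      ∃ root : V, IsDLT N (fun v => dltAlgorithm.output (states dltAlgorithm N nhat R v)) root ∧
        ∀ v, (dltAlgorithm.output (states dltAlgorithm N nhat R v)).label =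
          toLex (N.ident root, (parentGraph (parentOf N
            fun w => dltAlgorithm.output (states dltAlgorithm N nhat R w))).dist root v) := by
  have := hc.nonempty
  obtain ⟨p, hI, v₀, hv₀⟩ := exists_last_phase hid
  have hR := hI.phaseRun hid
  have hroot := hR.root_eq_of_all_eq_empty hc hv₀
  have hall : ∀ v, (dltStates N nhat (8 * p + 3) v).all = ∅ := fun v =>
    (hR.all_eq_of_notMem (v := v₀) (by rw [hv₀]; simp) (hroot v)).trans hv₀
  have hdone : ∀ v, (dltStates N nhat (8 * p + 4) v).done = true := fun v =>
    (hR.done_four v).trans (decide_eq_true (hall v))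
  refine ⟨p, (hI.card v₀).trans (Finset.card_le_univ _), fun v r hr => ?_, fun v =>
    awakeTime_staged_le (stageLen_dltPlan_pos nhat) (dltPlan_steady nhat) _ v, ?_⟩
  · obtain ⟨t, rfl⟩ := Nat.exists_eq_add_of_le hr
    exact not_isAwake_of_done (by rw [run_eq_of_done (hdone v)]; exact hdone v)
  · obtain ⟨r, h1, h2⟩ := hI.forest.exists_root v₀
    exact ⟨r, hI.forest.isDLT (σ := dltStates N nhat (8 * p + 4)) hR.core_four h1
      fun v => (hroot v).trans h2.symm⟩

theorem card_le_of_ident {V : Type*} [Fintype V] (N : Network V) {nhat : ℕ}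
    (hid : ∀ v, N.ident v ∈ Finset.Icc 1 nhat) : Fintype.card V ≤ nhat := by
  have := Finset.card_le_card_of_injOn (s := Finset.univ) N.ident (fun v _ => hid v)
    N.ident_injective.injOn
  simpa using this

end Sleeping

theorem mainTheorem8 :
    ∃ (A : Sleeping.Algorithm (Sleeping.DLTOutput (ℕ ×ₗ ℕ))) (C : ℝ),
      ∀ (V : Type*) [Fintype V] (N : Sleeping.Network V) (nhat : ℕ),
        N.graph.Connected →
        (∀ v, N.ident v ∈ Finset.Icc 1 nhat) →
        ∃ R : ℕ,
          (R : ℝ) ≤ C * (nhat * Real.logb 2 nhat * Sleeping.logStar nhat + 1) ∧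
          Sleeping.TerminatesWithin A N nhat R ∧
          (∀ v, (Sleeping.awakeTime A N nhat R v : ℝ) ≤
            C * (Real.logb 2 (Fintype.card V) * Sleeping.logStar (Fintype.card V) + 1)) ∧
          ∃ root : V,
            Sleeping.IsDLT N (fun v => A.output (Sleeping.states A N nhat R v)) root ∧
            ∀ v, (A.output (Sleeping.states A N nhat R v)).label =
              toLex (N.ident root,
                (Sleeping.parentGraph (Sleeping.parentOf N
                  fun w => A.output (Sleeping.states A N nhat R w))).dist root v) := by
  refine ⟨Sleeping.dltAlgorithm, 576, fun V _ N nhat hc hid => ?_⟩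
  obtain ⟨p, hp, h1, h2, h3⟩ := Sleeping.dltAlgorithm_correct N nhat hc hid
  refine ⟨_, Sleeping.startTime_bound hp (Sleeping.card_le_of_ident N hid), h1, fun v => ?_, h3⟩
  exact le_trans (by exact_mod_cast h2 v) (Sleeping.awake_bound hp)
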